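/- Fix an integer $d\ge 1$ and reals $\gamma>0$, $\beta>0$, $L>0$. For $C>0$ let $\mathcal H_\gamma(C)$ be the set of probability densities $p$ on $\mathbb R^d$ with $p(x)\le C\,(1+\|x\|^2)^{-(1+\gamma+d)/2}$ for all $x$, and let $\mathcal P_{\mathcal S}(\beta,L)$ be the set of probability densities $p$ with $$\int_{\mathbb R^d}|\omega^\alpha|^2\,|\mathcal F[p](\omega)|^2\,d\omega\le(2\pi)^dL^2\quad\text{for every }\alpha\in\mathbb N_0^d\text{ with }\alpha_1+\dots+\alpha_d=\beta,\qquad \mathcal F[p](\omega)=\int p(x)e^{-i\langle\omega,x\rangle}dx .$$ For a density $p_0$ and $t>0$ let $p_t=\varphi_t*p_0$, where $\varphi_t$ is the density of $\mathcal N(0,tI_d)$, and let $s_t=\nabla\log p_t$. Let $$\mathfrak M_C(n,t)=\inf_{\hat s_t}\ \sup_{p_0\in\mathcal H_\gamma(C)\cap\mathcal P_{\mathcal S}(\beta,L)}\ \mathbb E\Big[\int_{\mathbb R^d}\|\hat s_t(x)-s_t(x)\|^2\,p_t(x)\,dx\Big],$$ where the infimum is over all measurable estimators $\hat s_t$ based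 on $n$ i.i.d. observations from $p_0$. Call $C$ non-degenerate (for the given $d,\gamma,\beta,L$) if $\mathcal H_\gamma(C')\cap\mathcal P_{\mathcal S}(\beta,L')\ne\emptyset$ for some $C'<C$ and some $0<L'<L$. Put $$r=\frac{\gamma+1}{d+\gamma+1},\qquad \tau=\frac{2(d+2\gamma+2)}{d(d+2(\gamma+1))+2\beta(d+\gamma+1)} .$$ Then every sufficiently large $C$ is non-degenerate. Moreover, for every non-degenerate $C$, every $\delta>0$ and all constants $a,b>0$ there are $c>0$ and $n_0\in\mathbb N$ such that, for all $n\ge n_0$ and all $t$ with $a\,n^{-\tau}\le t\le b$, $$\mathfrak M_C(n,t)\ \ge\ c\,n^{-r-\delta}\,t^{-1-\frac d2 r+\delta},$$ and, if $d\ge2$, also $$\mathfrak M_C(n,t)\ \ge\ c\,n^{-r-\delta}\,t^{-1-r+\delta}.$$ -/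

import Mathlib

open MeasureTheory Real
open scoped ENNReal

noncomputable section

/-- Probability densities on `ℝ^d` with respect to Lebesgue measure. -/
def IsDensity {d : ℕ} (p : EuclideanSpace ℝ (Fin d) → ℝ) : Prop :=
  Integrable p ∧ (∀ x, 0 ≤ p x) ∧ ∫ x, p x = 1

/-- Densities with polynomial tails of index `γ` and constant `C`. -/
def tailClass (d : ℕ) (γ C : ℝ) : Set (EuclideanSpace ℝ (Fin d) → ℝ) :=
  {p | IsDensity p ∧ ∀ x, p x ≤ C / (1 + ‖x‖ ^ 2) ^ ((1 + γ + d) / 2)}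

/-- The Fourier transform `∫ p(x) exp(-i⟨ω, x⟩) dx`. -/
def fourierTr {d : ℕ} (p : EuclideanSpace ℝ (Fin d) → ℝ)
    (ω : EuclideanSpace ℝ (Fin d)) : ℂ :=
  ∫ x, (p x : ℂ) * Complex.exp (-Complex.I * ((inner ℝ ω x : ℝ) : ℂ))

/-- The Sobolev class of densities with smoothness `β` and radius `L`. -/
def sobolevClass (d : ℕ) (β L : ℝ) : Set (EuclideanSpace ℝ (Fin d) → ℝ) :=
  {p | IsDensity p ∧ ∀ α : Fin d → ℕ, ∑ i, (α i : ℝ) = β →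
    ∫⁻ ω : EuclideanSpace ℝ (Fin d),
        ENNReal.ofReal (|∏ i, ω i ^ α i| ^ 2 * ‖fourierTr p ω‖ ^ 2)
      ≤ ENNReal.ofReal ((2 * π) ^ d * L ^ 2)}

/-- The model class: polynomial tails and Sobolev smoothness. -/
def modelClass (d : ℕ) (γ C β L : ℝ) : Set (EuclideanSpace ℝ (Fin d) → ℝ) :=
  tailClass d γ C ∩ sobolevClass d β L

/-- The radii `C`, `L` are non-degenerate: some density satisfies both constraints with
room to spare. (Otherwise the model class may be empty or a single point.) -/
def NondegenerateRadii (d : ℕ) (γ C β L : ℝ) : Prop :=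
  ∃ C' L' : ℝ, C' < C ∧ 0 < L' ∧ L' < L ∧ (modelClass d γ C' β L').Nonempty

/-- The density of the centred Gaussian with covariance `t • I`. -/
def gaussKernel {d : ℕ} (t : ℝ) (x : EuclideanSpace ℝ (Fin d)) : ℝ :=
  1 / (2 * π * t) ^ ((d : ℝ) / 2) * exp (-‖x‖ ^ 2 / (2 * t))

/-- The density `p_t = φ_t * p` of `X₀ + √t Z`, with `X₀ ~ p` and `Z` standard Gaussian. -/
def smoothed {d : ℕ} (p : EuclideanSpace ℝ (Fin d) → ℝ) (t : ℝ)
    (x : EuclideanSpace ℝ (Fin d)) : ℝ :=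
  ∫ y, gaussKernel t (x - y) * p y

/-- The score `s_t = ∇ log p_t`. -/
def score {d : ℕ} (p : EuclideanSpace ℝ (Fin d) → ℝ) (t : ℝ)
    (x : EuclideanSpace ℝ (Fin d)) : EuclideanSpace ℝ (Fin d) :=
  gradient (fun z => log (smoothed p t z)) x

/-- The law of `n` independent observations with density `p`. -/
def sampleLaw {d : ℕ} (p : EuclideanSpace ℝ (Fin d) → ℝ) (n : ℕ) :
    Measure (Fin n → EuclideanSpace ℝ (Fin d)) :=
  Measure.pi fun _ => volume.withDensity fun x => ENNReal.ofReal (p x)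

/-- The risk `E ∫ ‖ŝ(x) - s_t(x)‖² p_t(x) dx` of an estimator `s` built from `n` observations. -/
def scoreRisk {d n : ℕ}
    (s : (Fin n → EuclideanSpace ℝ (Fin d)) →
      EuclideanSpace ℝ (Fin d) → EuclideanSpace ℝ (Fin d))
    (p : EuclideanSpace ℝ (Fin d) → ℝ) (t : ℝ) : ℝ≥0∞ :=
  ∫⁻ X, (∫⁻ x, ENNReal.ofReal (‖s X x - score p t x‖ ^ 2 * smoothed p t x)) ∂(sampleLaw p n)

/-- The minimax risk over a class `P` of densities, the infimum being over all (jointly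
measurable) estimators of `s_t` from `n` observations. -/
def minimaxRisk {d : ℕ} (P : Set (EuclideanSpace ℝ (Fin d) → ℝ)) (n : ℕ) (t : ℝ) : ℝ≥0∞ :=
  ⨅ (s : (Fin n → EuclideanSpace ℝ (Fin d)) →
      EuclideanSpace ℝ (Fin d) → EuclideanSpace ℝ (Fin d))
    (_ : Measurable (Function.uncurry s)),
    ⨆ p ∈ P, scoreRisk s p t

/-- The rate exponent `(γ + 1) / (d + γ + 1)`. -/
def rateExp (d : ℕ) (γ : ℝ) : ℝ := (γ + 1) / (d + γ + 1)

/-- The exponent in the lower end `n ^ (-timeExp)` of the range of diffusion times. -/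
def timeExp (d : ℕ) (γ β : ℝ) : ℝ :=
  2 * (d + 2 * γ + 2) / (d * (d + 2 * (γ + 1)) + 2 * β * (d + γ + 1))

end

/-! ### Gaussian smoothing and the score -/

section Smoothing

variable {d : ℕ}

local notation "E" => EuclideanSpace ℝ (Fin d)

/-! The lower bound comes from bumps placed so far out that a sample is likely to miss any given one
of them. Write `T = 1 + γ + d`, `s = √t`, and let `R` solve `R ^ T = n s ^ d`. Around radius `R`, a
density at the edge of the tail class has height of order `R ^ (-T)`, so a bump of that height and
width `s` has mass of order `1 / n`. Take a density `q` with room to spare in both constraints,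
shrink it slightly, and add about `(R / s) ^ d` such bumps on a grid, each displaced by `2 s` in one
of two opposite directions. This gives a hypercube of densities.

Testing: two neighbours on the cube both dominate the density with the moved bump removed, whose
mass is at least `1 - 1 / (2 n)`. Its `n`-fold product has mass at least `1 / 2` and lies below both
sample laws (`le_localRisk_add_localRisk`). Assouad's lemma (`le_minimaxRisk_of_hypercube`) then
sums the local losses.

Separation: at radius `R` the smoothed background is also `O(R ^ (-T))`, comparable to a bump
(`exists_smoothed_tail_le`). Moving a bump therefore changes `log p_t` by a constant over a distance
of order `s`, and the score by order `1 / s` in mean square (`exists_separation_bump`). Each bump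
costs `R ^ (-T) s ^ d / s ^ 2`, so the total is `R ^ (d - T) / t = n ^ (-r) t ^ (-1 - d r / 2)`.

Membership: disjoint bumps have Sobolev energy of order `R ^ (d - 2 T) s ^ (-2 β)`, and this is
bounded because `t ≥ a n ^ (-τ)` (`exists_bumpSum_mem_modelClass`, `exists_radius_bounds`). The
losses `n ^ (-δ)` and `t ^ δ` are not needed, and for `d ≥ 2` the second bound is weaker than the
first up to a constant because `t ≤ b`. -/

theorem gaussKernel_pos {t : ℝ} (ht : 0 < t) (x : E) : 0 < gaussKernel t x := by
  unfold gaussKernel; positivity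

theorem gaussKernel_le {t : ℝ} (ht : 0 < t) (x : E) :
    gaussKernel t x ≤ 1 / (2 * π * t) ^ ((d : ℝ) / 2) := by
  unfold gaussKernel
  have h1 : exp (-‖x‖ ^ 2 / (2 * t)) ≤ 1 := by
    rw [exp_le_one_iff, neg_div]
    have : 0 ≤ ‖x‖ ^ 2 / (2 * t) := by positivity
    linarith
  have h2 : 0 ≤ 1 / (2 * π * t) ^ ((d : ℝ) / 2) := by positivity
  nlinarith

theorem continuous_gaussKernel (t : ℝ) : Continuous (gaussKernel t : E → ℝ) := by
  unfold gaussKernel; fun_prop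

theorem hasFDerivAt_gaussKernel {t : ℝ} (ht : 0 < t) (x : E) :
    HasFDerivAt (gaussKernel t) ((-(gaussKernel t x) / t) • innerSL ℝ x) x := by
  have h1 : HasFDerivAt (fun y : E => -‖y‖ ^ 2 / (2 * t)) ((-1 / t) • innerSL ℝ x) x := by
    have h := ((hasStrictFDerivAt_norm_sq x).hasFDerivAt).const_mul (-1 / (2 * t))
    have h' : (fun y : E => -‖y‖ ^ 2 / (2 * t)) = fun y => -1 / (2 * t) * ‖y‖ ^ 2 := by
      ext y; ring
    rw [h']
    refine h.congr_fderiv ?_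
    ext y
    simp
    field_simp
  have h2 := (h1.exp).const_mul (1 / (2 * π * t) ^ ((d : ℝ) / 2))
  refine h2.congr_fderiv ?_
  ext y
  simp [gaussKernel]
  ring

theorem exists_norm_gaussKernel_fderiv_le {t : ℝ} (ht : 0 < t) :
    ∃ M : ℝ, ∀ x : E, ‖(-(gaussKernel t x) / t) • innerSL ℝ x‖ ≤ M := by
  refine ⟨(1 / (2 * π * t) ^ ((d : ℝ) / 2)) / t * (1 + 2 * t), fun x => ?_⟩
  rw [norm_smul, innerSL_apply_norm, norm_div, norm_neg, Real.norm_of_nonneg (gaussKernel_pos ht x).le,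
    Real.norm_of_nonneg ht.le]
  unfold gaussKernel
  have h1 : ‖x‖ ≤ (1 + 2 * t) * exp (‖x‖ ^ 2 / (2 * t)) := by
    have h2 := add_one_le_exp (‖x‖ ^ 2 / (2 * t))
    have h3 : (1 + 2 * t) * (‖x‖ ^ 2 / (2 * t) + 1) ≤ (1 + 2 * t) * exp (‖x‖ ^ 2 / (2 * t)) := by
      gcongr
    have h4 : (1 + 2 * t) * (‖x‖ ^ 2 / (2 * t) + 1) = ‖x‖ ^ 2 / (2 * t) + ‖x‖ ^ 2 + 1 + 2 * t := by
      field_simp; ring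
    have h5 : 0 ≤ ‖x‖ ^ 2 / (2 * t) := by positivity
    nlinarith [sq_nonneg (‖x‖ - 1)]
  have h6 : exp (-‖x‖ ^ 2 / (2 * t)) * ‖x‖ ≤ 1 + 2 * t := by
    rw [neg_div, exp_neg, inv_mul_le_iff₀ (exp_pos _), mul_comm]
    exact h1
  calc _ = (1 / (2 * π * t) ^ ((d : ℝ) / 2)) / t * (exp (-‖x‖ ^ 2 / (2 * t)) * ‖x‖) := by ring
    _ ≤ _ := by gcongr

theorem integrable_gaussKernel_mul {p : E → ℝ} (hp : Integrable p) {t : ℝ} (ht : 0 < t) (x : E) :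
    Integrable fun y => gaussKernel t (x - y) * p y := by
  refine hp.bdd_mul (c := 1 / (2 * π * t) ^ ((d : ℝ) / 2)) ?_ ?_
  · exact ((continuous_gaussKernel t).comp (by fun_prop)).aestronglyMeasurable
  · refine .of_forall fun y => ?_
    rw [Real.norm_of_nonneg (gaussKernel_pos ht _).le]
    exact gaussKernel_le ht _

/-- The kernel has a bounded derivative, so a multiple of `‖p‖` dominates and differentiation under
the integral works for any integrable `p`. -/
theorem contDiff_smoothed {p : E → ℝ} (hp : Integrable p) {t : ℝ} (ht : 0 < t) :
    ContDiff ℝ 1 (smoothed p t) := by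
  obtain ⟨M, hM⟩ := exists_norm_gaussKernel_fderiv_le (d := d) ht
  set K : E → E →L[ℝ] ℝ := fun x => (-(gaussKernel t x) / t) • innerSL ℝ x with hK
  have hKc : Continuous K := by
    have := continuous_gaussKernel (d := d) t
    fun_prop
  have hm : ∀ x, AEStronglyMeasurable (fun y => p y • K (x - y)) volume := fun x =>
    hp.aestronglyMeasurable.smul (hKc.comp (by fun_prop)).aestronglyMeasurable
  have hb : ∀ x y, ‖p y • K (x - y)‖ ≤ ‖p y‖ * M := fun x y => by
    rw [norm_smul]; gcongr; exact hM _
  have hd : ∀ x, HasFDerivAt (smoothed p t) (∫ y, p y • K (x - y)) x := by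
    intro x
    refine hasFDerivAt_integral_of_dominated_of_fderiv_le (𝕜 := ℝ) (s := Set.univ) (bound := fun y => ‖p y‖ * M)
      (F' := fun x y => p y • K (x - y)) Filter.univ_mem
      (.of_forall fun z => (integrable_gaussKernel_mul hp ht z).aestronglyMeasurable)
      (integrable_gaussKernel_mul hp ht x) (hm x) (.of_forall fun y z _ => hb z y)
      (hp.norm.mul_const M) (.of_forall fun y z _ => ?_)
    have h1 := ((hasFDerivAt_gaussKernel ht (z - y)).comp z
      ((hasFDerivAt_id z).sub_const y)).mul_const (p y)
    exact h1
  rw [contDiff_one_iff_fderiv]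
  refine ⟨fun x => (hd x).differentiableAt, ?_⟩
  have : fderiv ℝ (smoothed p t) = fun x => ∫ y, p y • K (x - y) := funext fun x => (hd x).fderiv
  rw [this]
  refine continuous_of_dominated hm (fun x => .of_forall fun y => hb x y)
    (hp.norm.mul_const M) (.of_forall fun y => ?_)
  exact (hKc.comp (by fun_prop)).const_smul (p y)

theorem smoothed_nonneg {p : E → ℝ} (hp : ∀ x, 0 ≤ p x) {t : ℝ} (ht : 0 < t) (x : E) :
    0 ≤ smoothed p t x :=
  integral_nonneg fun y => mul_nonneg (gaussKernel_pos ht _).le (hp y)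

theorem smoothed_pos {p : E → ℝ} (hi : Integrable p) (hp : ∀ x, 0 ≤ p x) (h1 : 0 < ∫ x, p x)
    {t : ℝ} (ht : 0 < t) (x : E) : 0 < smoothed p t x := by
  unfold smoothed
  rw [integral_pos_iff_support_of_nonneg
    (fun y => mul_nonneg (gaussKernel_pos ht _).le (hp y)) (integrable_gaussKernel_mul hi ht x)]
  rw [integral_pos_iff_support_of_nonneg hp hi] at h1
  convert h1 using 2
  ext y
  simp [(gaussKernel_pos ht (x - y)).ne']

theorem smoothed_add {p q : E → ℝ} (hp : Integrable p) (hq : Integrable q) {t : ℝ} (ht : 0 < t)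
    (x : E) : smoothed (fun y => p y + q y) t x = smoothed p t x + smoothed q t x := by
  unfold smoothed
  rw [← integral_add (integrable_gaussKernel_mul hp ht x) (integrable_gaussKernel_mul hq ht x)]
  simp_rw [mul_add]

theorem smoothed_const_mul (c : ℝ) (p : E → ℝ) (t : ℝ) (x : E) :
    smoothed (fun y => c * p y) t x = c * smoothed p t x := by
  unfold smoothed
  rw [← integral_const_mul]
  congr 1; ext y; ring

theorem contDiff_log_smoothed {p : E → ℝ} (hi : Integrable p) (hp : ∀ x, 0 ≤ p x)
    (h1 : 0 < ∫ x, p x) {t : ℝ} (ht : 0 < t) : ContDiff ℝ 1 fun x => log (smoothed p t x) :=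
  (contDiff_smoothed hi ht).log fun x => (smoothed_pos hi hp h1 ht x).ne'

/-- Turns the distance between scores into the Dirichlet energy of a log ratio, which can be bounded
below from increments alone. -/
theorem norm_score_sub_score {p q : E → ℝ} {t : ℝ} {x : E}
    (hp : DifferentiableAt ℝ (fun x => log (smoothed p t x)) x)
    (hq : DifferentiableAt ℝ (fun x => log (smoothed q t x)) x) :
    ‖score p t x - score q t x‖
      = ‖fderiv ℝ (fun x => log (smoothed p t x) - log (smoothed q t x)) x‖ := by
  unfold score gradient
  rw [← map_sub, LinearIsometryEquiv.norm_map, fderiv_fun_sub hp hq]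

theorem measurable_score (p : E → ℝ) (t : ℝ) : Measurable (score p t) := by
  unfold score gradient
  exact (LinearIsometryEquiv.continuous _).measurable.comp (measurable_fderiv ℝ _)

end Smoothing

/-! ### Dirichlet energy from increments along segments -/

section Energy

variable {d : ℕ}

local notation "E" => EuclideanSpace ℝ (Fin d)

/-- The fundamental theorem of calculus along a segment, followed by Cauchy–Schwarz over a parameter
interval of length 4. -/
theorem lintegral_fderiv_sq_segment_ge {h : E → ℝ} (hh : ContDiff ℝ 1 h) {v y : E} {σ κ : ℝ}
    (hσ : 0 < σ) (hκ : 0 < κ) (hv : ‖v‖ = σ) (hd : κ ≤ h (y + (2 : ℝ) • v) - h (y + (-2 : ℝ) • v)) :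
    ENNReal.ofReal (κ ^ 2 / (4 * σ ^ 2))
      ≤ ∫⁻ r in Set.Ioc (-2 : ℝ) 2, ENNReal.ofReal (‖fderiv ℝ h (y + r • v)‖ ^ 2) := by
  have hc : Continuous (fderiv ℝ h) := hh.continuous_fderiv (by simp)
  have hline : ∀ r : ℝ, HasDerivAt (fun r : ℝ => h (y + r • v)) (fderiv ℝ h (y + r • v) v) r := by
    intro r
    have h1 : HasDerivAt (fun r : ℝ => y + r • v) v r := by
      simpa using ((hasDerivAt_id r).smul_const v).const_add y
    exact ((hh.differentiable (by simp)) (y + r • v)).hasFDerivAt.comp_hasDerivAt r h1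
  have hcl : Continuous fun r : ℝ => fderiv ℝ h (y + r • v) := hc.comp (by fun_prop)
  have hI := intervalIntegral.integral_eq_sub_of_hasDerivAt (a := (-2 : ℝ)) (b := 2)
    (fun r _ => hline r) ((hcl.clm_apply continuous_const).intervalIntegrable _ _)
  -- Cauchy–Schwarz in the form of a pointwise Young inequality: `κ / 8` integrates to `κ / 2`,
  -- which half of the increment absorbs.
  have hle : ∫ r in (-2 : ℝ)..2, fderiv ℝ h (y + r • v) v
      ≤ ∫ r in (-2 : ℝ)..2, (κ / 8 + 2 * σ ^ 2 / κ * ‖fderiv ℝ h (y + r • v)‖ ^ 2) := by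
    refine intervalIntegral.integral_mono_on (by norm_num)
      ((hcl.clm_apply continuous_const).intervalIntegrable _ _)
      ((by fun_prop : Continuous fun r : ℝ =>
        κ / 8 + 2 * σ ^ 2 / κ * ‖fderiv ℝ h (y + r • v)‖ ^ 2).intervalIntegrable _ _)
      fun r _ => ?_
    have h2 : fderiv ℝ h (y + r • v) v ≤ ‖fderiv ℝ h (y + r • v)‖ * σ := by
      rw [← hv]; exact (le_abs_self _).trans ((fderiv ℝ h (y + r • v)).le_opNorm v)
    refine h2.trans ?_
    set a := ‖fderiv ℝ h (y + r • v)‖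
    have h3 : κ / 8 + 2 * σ ^ 2 / κ * a ^ 2 - a * σ = 2 / κ * (a * σ - κ / 4) ^ 2 := by
      field_simp; ring
    have h4 : 0 ≤ 2 / κ * (a * σ - κ / 4) ^ 2 := by positivity
    linarith
  rw [intervalIntegral.integral_add (by simp)
    ((by fun_prop : Continuous fun r : ℝ =>
        2 * σ ^ 2 / κ * ‖fderiv ℝ h (y + r • v)‖ ^ 2).intervalIntegrable _ _),
    intervalIntegral.integral_const_mul, intervalIntegral.integral_const] at hle
  have hfin : κ ^ 2 / (4 * σ ^ 2) ≤ ∫ r in (-2 : ℝ)..2, ‖fderiv ℝ h (y + r • v)‖ ^ 2 := by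
    set J := ∫ r in (-2 : ℝ)..2, ‖fderiv ℝ h (y + r • v)‖ ^ 2
    have h5 : κ ≤ κ / 2 + 2 * σ ^ 2 / κ * J := by
      refine hd.trans ?_
      rw [← hI]
      refine hle.trans (le_of_eq ?_)
      simp; ring
    rw [div_le_iff₀ (by positivity)]
    have h6 : 2 * σ ^ 2 / κ * J = 2 * σ ^ 2 * J / κ := by ring
    have h7 : κ / 2 ≤ 2 * σ ^ 2 * J / κ := by linarith
    rw [le_div_iff₀ hκ] at h7
    nlinarith
  rw [intervalIntegral.integral_of_le (by norm_num)] at hfin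
  refine (ENNReal.ofReal_le_ofReal hfin).trans ?_
  rw [ofReal_integral_eq_lintegral_ofReal]
  · exact ((by fun_prop : Continuous fun r : ℝ =>
        ‖fderiv ℝ h (y + r • v)‖ ^ 2).intervalIntegrable (-2) 2).1
  · exact .of_forall fun r => by positivity

/-- A lower bound for the Dirichlet energy of a function that increases along a bundle of
parallel segments. -/
theorem lintegral_fderiv_sq_ball_ge {h : E → ℝ} (hh : ContDiff ℝ 1 h) {v x₀ : E} {σ κ : ℝ}
    (hσ : 0 < σ) (hκ : 0 < κ) (hv : ‖v‖ = σ)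
    (hd : ∀ y ∈ Metric.ball x₀ (σ / 2), κ ≤ h (y + (2 : ℝ) • v) - h (y + (-2 : ℝ) • v)) :
    ENNReal.ofReal (κ ^ 2 / (16 * σ ^ 2)) * volume (Metric.ball x₀ (σ / 2))
      ≤ ∫⁻ x in Metric.ball x₀ (3 * σ), ENNReal.ofReal (‖fderiv ℝ h x‖ ^ 2) := by
  have hc : Continuous (fderiv ℝ h) := hh.continuous_fderiv (by simp)
  set f : E → ℝ≥0∞ := fun x => ENNReal.ofReal (‖fderiv ℝ h x‖ ^ 2) with hf
  have hfc : Continuous f := ENNReal.continuous_ofReal.comp (by fun_prop)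
  have h1 : ENNReal.ofReal (κ ^ 2 / (4 * σ ^ 2)) * volume (Metric.ball x₀ (σ / 2))
      ≤ ∫⁻ y in Metric.ball x₀ (σ / 2), ∫⁻ r in Set.Ioc (-2 : ℝ) 2, f (y + r • v) := by
    rw [← setLIntegral_const]
    refine setLIntegral_mono' measurableSet_ball fun y hy => ?_
    exact lintegral_fderiv_sq_segment_ge hh hσ hκ hv (hd y hy)
  have hm : Continuous (Function.uncurry fun (y : E) (r : ℝ) => f (y + r • v)) :=
    hfc.comp (by fun_prop : Continuous fun z : E × ℝ => z.1 + z.2 • v)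
  rw [lintegral_lintegral_swap hm.measurable.aemeasurable] at h1
  -- For each `r` the translated small ball stays within radius `σ / 2 + 2 σ < 3 σ`. The outer
  -- integral then contributes only its length 4, which turns `4 σ ^ 2` into `16 σ ^ 2`.
  have h2 : ∫⁻ r in Set.Ioc (-2 : ℝ) 2, ∫⁻ y in Metric.ball x₀ (σ / 2), f (y + r • v)
      ≤ ∫⁻ r in Set.Ioc (-2 : ℝ) 2, ∫⁻ x in Metric.ball x₀ (3 * σ), f x := by
    refine setLIntegral_mono' measurableSet_Ioc fun r hr => ?_
    rw [← lintegral_indicator measurableSet_ball, ← lintegral_indicator measurableSet_ball,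
      ← lintegral_add_right_eq_self ((Metric.ball x₀ (3 * σ)).indicator f) (r • v)]
    refine lintegral_mono fun y => ?_
    by_cases hy : y ∈ Metric.ball x₀ (σ / 2)
    swap
    · rw [Set.indicator_of_notMem hy]; exact bot_le
    rw [Set.indicator_of_mem hy, Set.indicator_of_mem]
    rw [Metric.mem_ball, dist_eq_norm] at hy ⊢
    have h3 : ‖r • v‖ ≤ 2 * σ := by
      rw [norm_smul, hv]
      gcongr
      rw [Real.norm_eq_abs, abs_le]; exact ⟨hr.1.le, hr.2⟩
    calc ‖y + r • v - x₀‖ = ‖(y - x₀) + r • v‖ := by congr 1; abel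
      _ ≤ ‖y - x₀‖ + ‖r • v‖ := norm_add_le _ _
      _ < 3 * σ := by linarith
  have h3 := h1.trans h2
  rw [setLIntegral_const, Real.volume_Ioc] at h3
  have h4 : ENNReal.ofReal (κ ^ 2 / (4 * σ ^ 2))
      = ENNReal.ofReal (κ ^ 2 / (16 * σ ^ 2)) * 4 := by
    rw [show (4 : ℝ≥0∞) = ENNReal.ofReal 4 by simp, ← ENNReal.ofReal_mul (by positivity)]
    congr 1; field_simp; norm_num
  have h5 : ENNReal.ofReal (2 - -2) = 4 := by norm_num
  rw [h4, h5, mul_right_comm] at h3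
  exact (ENNReal.mul_le_mul_iff_left (by simp) (by simp)).1 h3

end Energy

/-! ### Monotonicity and mass of product measures -/

section ProductLaw

/-- The product outer measure is the largest one bounded by the product on boxes, so comparison on
boxes suffices. -/
theorem pi_mono_of_le {ι : Type*} [Fintype ι] {α : ι → Type*} [∀ i, MeasurableSpace (α i)]
    {μ ν : ∀ i, Measure (α i)} (h : ∀ i, μ i ≤ ν i) : Measure.pi μ ≤ Measure.pi ν := by
  rw [Measure.le_iff]
  intro s hs
  rw [Measure.pi_def, Measure.pi_def, toMeasure_apply _ _ hs, toMeasure_apply _ _ hs]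
  have : OuterMeasure.pi (fun i => (μ i).toOuterMeasure)
      ≤ OuterMeasure.pi (fun i => (ν i).toOuterMeasure) := by
    rw [OuterMeasure.le_pi]
    intro u _
    exact (OuterMeasure.pi_pi_le _ _).trans (Finset.prod_le_prod' fun i _ => h i (u i))
  exact this s

variable {d : ℕ}

local notation "E" => EuclideanSpace ℝ (Fin d)

theorem sampleLaw_mono {p q : E → ℝ} (h : ∀ x, p x ≤ q x) (n : ℕ) :
    sampleLaw p n ≤ sampleLaw q n :=
  pi_mono_of_le fun _ => withDensity_mono (.of_forall fun x => ENNReal.ofReal_le_ofReal (h x))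

/-- Bernoulli's inequality: `(1 - 1 / (2 n)) ^ n ≥ 1 / 2`. Here `p` is meant to be a sub-density,
the common part of two hypotheses. -/
theorem sampleLaw_univ_ge {p : E → ℝ} (hi : Integrable p) (hp : ∀ x, 0 ≤ p x) {n : ℕ}
    (h1 : 1 - ∫ x, p x ≤ 1 / (2 * n)) :
    1 / 2 ≤ sampleLaw p n Set.univ := by
  have := isFiniteMeasure_withDensity_ofReal hi.2
  unfold sampleLaw
  rw [Measure.pi_univ]
  simp only [withDensity_apply _ MeasurableSet.univ, Measure.restrict_univ, Finset.prod_const,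
    Finset.card_univ, Fintype.card_fin]
  rw [← ofReal_integral_eq_lintegral_ofReal hi (.of_forall hp),
    ← ENNReal.ofReal_pow (integral_nonneg fun x => hp x)]
  have h2 : (1 / 2 : ℝ) ≤ (∫ x, p x) ^ n := by
    rcases Nat.eq_zero_or_pos n with rfl | hn
    · norm_num
    have h3 := one_add_mul_le_pow (a := (∫ x, p x) - 1)
      (by linarith [integral_nonneg hp (μ := volume) (f := p)]) n
    rw [add_sub_cancel] at h3
    refine le_trans ?_ h3
    have h4 : (0 : ℝ) < n := by exact_mod_cast hn
    have h5 : n * (1 - ∫ x, p x) ≤ n * (1 / (2 * n)) := by gcongr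
    have h6 : (n : ℝ) * (1 / (2 * n)) = 1 / 2 := by field_simp
    linarith
  calc (1 / 2 : ℝ≥0∞) = ENNReal.ofReal (1 / 2) := by
        rw [ENNReal.ofReal_div_of_pos (by norm_num)]; simp
    _ ≤ _ := ENNReal.ofReal_le_ofReal h2

end ProductLaw

/-! ### Two-point testing and Assouad's lemma -/

section Assouad

/-- This direction holds for arbitrary integrands, so the inner integrals need not be shown
measurable in the sample. -/
theorem finset_sum_lintegral_le {α ι : Type*} [MeasurableSpace α] (μ : Measure α) (s : Finset ι)
    (f : ι → α → ℝ≥0∞) : ∑ i ∈ s, ∫⁻ x, f i x ∂μ ≤ ∫⁻ x, ∑ i ∈ s, f i x ∂μ := by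
  classical
  induction s using Finset.induction_on with
  | empty => simp
  | insert i s hi ih =>
    simp only [Finset.sum_insert hi]
    exact (add_le_add_right ih _).trans (le_lintegral_add _ _)

variable {d n : ℕ}

local notation "E" => EuclideanSpace ℝ (Fin d)

/-- The contribution of the region `A` to the risk of an estimator. -/
noncomputable def localRisk (s : (Fin n → E) → E → E) (p : E → ℝ) (t : ℝ) (A : Set E) : ℝ≥0∞ :=
  ∫⁻ X, (∫⁻ x in A, ENNReal.ofReal (‖s X x - score p t x‖ ^ 2 * smoothed p t x)) ∂(sampleLaw p n)

theorem sum_localRisk_le {K : Type*} [Fintype K] (s : (Fin n → E) → E → E) (p : E → ℝ) (t : ℝ)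
    {A : K → Set E} (hA : ∀ k, MeasurableSet (A k))
    (hd : Pairwise (Function.onFun Disjoint A)) :
    ∑ k, localRisk s p t (A k) ≤ scoreRisk s p t := by
  refine (finset_sum_lintegral_le _ _ _).trans (lintegral_mono fun X => ?_)
  rw [← lintegral_biUnion_finset (fun i _ j _ hij => hd hij) (fun k _ => hA k)]
  exact setLIntegral_le_lintegral _ _

/-- Both sample laws dominate that of `g`, which has mass at least `1 / 2`. Under this common
measure the estimator sees the same data in both cases and cannot be close to both scores. -/
theorem le_localRisk_add_localRisk {s : (Fin n → E) → E → E} (hs : Measurable (Function.uncurry s))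
    {p q g : E → ℝ} {t : ℝ} (ht : 0 < t) (hp : Integrable p)
    (hg : Integrable g) (hg0 : ∀ x, 0 ≤ g x) (hgp : ∀ x, g x ≤ p x) (hgq : ∀ x, g x ≤ q x)
    (hg1 : 1 - ∫ x, g x ≤ 1 / (2 * n)) {A : Set E} {Δ : ℝ≥0∞}
    (hsep : ∀ f : E → E, Measurable f →
      Δ ≤ (∫⁻ x in A, ENNReal.ofReal (‖f x - score p t x‖ ^ 2 * smoothed p t x))
        + ∫⁻ x in A, ENNReal.ofReal (‖f x - score q t x‖ ^ 2 * smoothed q t x)) :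
    Δ / 2 ≤ localRisk s p t A + localRisk s q t A := by
  have h1 : localRisk s p t A ≥ ∫⁻ X, (∫⁻ x in A,
      ENNReal.ofReal (‖s X x - score p t x‖ ^ 2 * smoothed p t x)) ∂(sampleLaw g n) :=
    lintegral_mono' (sampleLaw_mono hgp n) le_rfl
  have h2 : localRisk s q t A ≥ ∫⁻ X, (∫⁻ x in A,
      ENNReal.ofReal (‖s X x - score q t x‖ ^ 2 * smoothed q t x)) ∂(sampleLaw g n) :=
    lintegral_mono' (sampleLaw_mono hgq n) le_rfl
  refine le_trans ?_ (add_le_add h1 h2)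
  rw [← lintegral_add_left]
  · calc Δ / 2 ≤ Δ * sampleLaw g n Set.univ := by
          rw [div_eq_mul_one_div]; gcongr; exact sampleLaw_univ_ge hg hg0 hg1
      _ = ∫⁻ X, Δ ∂(sampleLaw g n) := by rw [lintegral_const]
      _ ≤ _ := lintegral_mono fun X => hsep (s X) (hs.comp measurable_prodMk_left)
  · refine Measurable.lintegral_prod_right' (f := fun z : (Fin n → E) × E =>
      ENNReal.ofReal (‖s z.1 z.2 - score p t z.2‖ ^ 2 * smoothed p t z.2)) ?_
    have h3 : Measurable fun z : (Fin n → E) × E => s z.1 z.2 := hs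
    have h4 : Measurable fun z : (Fin n → E) × E => score p t z.2 :=
      (measurable_score p t).comp measurable_snd
    have h5 : Measurable fun z : (Fin n → E) × E => smoothed p t z.2 :=
      (contDiff_smoothed hp ht).continuous.measurable.comp measurable_snd
    exact (((h3.sub h4).norm.pow_const 2).mul h5).ennreal_ofReal

/-- Flipping one coordinate of a Boolean vector. -/
def flipAt {K : Type*} [DecidableEq K] (k : K) (θ : K → Bool) : K → Bool :=
  Function.update θ k (!θ k)

theorem flipAt_involutive {K : Type*} [DecidableEq K] (k : K) :
    Function.Involutive (flipAt k) := by
  intro θ; simp [flipAt]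

/-- Assouad's lemma for the score matching risk over a family of densities indexed by a
hypercube. -/
theorem le_minimaxRisk_of_hypercube {K : Type*} [Fintype K] [DecidableEq K]
    {P : Set (E → ℝ)} {t : ℝ} (ht : 0 < t) {p : (K → Bool) → E → ℝ} (hP : ∀ θ, p θ ∈ P)
    (hp : ∀ θ, Integrable (p θ)) {A : K → Set E} (hA : ∀ k, MeasurableSet (A k))
    (hd : Pairwise (Function.onFun Disjoint A)) {Δ : ℝ≥0∞}
    (hg : ∀ k θ, ∃ g : E → ℝ, Integrable g ∧ (∀ x, 0 ≤ g x) ∧ (∀ x, g x ≤ p θ x) ∧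
      (∀ x, g x ≤ p (flipAt k θ) x) ∧ 1 - ∫ x, g x ≤ 1 / (2 * n))
    (hsep : ∀ k θ, ∀ f : E → E, Measurable f →
      Δ ≤ (∫⁻ x in A k, ENNReal.ofReal (‖f x - score (p θ) t x‖ ^ 2 * smoothed (p θ) t x))
        + ∫⁻ x in A k, ENNReal.ofReal
          (‖f x - score (p (flipAt k θ)) t x‖ ^ 2 * smoothed (p (flipAt k θ)) t x)) :
    Fintype.card K * (Δ / 4) ≤ minimaxRisk P n t := by
  unfold minimaxRisk
  refine le_iInf₂ fun s hs => ?_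
  set S := ⨆ p ∈ P, scoreRisk s p t with hS
  have h1 : ∀ θ, ∑ k, localRisk s (p θ) t (A k) ≤ S := fun θ =>
    (sum_localRisk_le s (p θ) t hA hd).trans (le_iSup₂_of_le (p θ) (hP θ) le_rfl)
  have h2 : ∀ k θ, Δ / 2 ≤ localRisk s (p θ) t (A k) + localRisk s (p (flipAt k θ)) t (A k) := by
    intro k θ
    obtain ⟨g, hgi, hg0, hgp, hgq, hg1⟩ := hg k θ
    exact le_localRisk_add_localRisk hs ht (hp θ) hgi hg0 hgp hgq hg1 (hsep k θ)
  have h3 : ∀ k, ∑ θ, localRisk s (p (flipAt k θ)) t (A k) = ∑ θ, localRisk s (p θ) t (A k) :=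
    fun k => Equiv.sum_comp (flipAt_involutive k).toPerm fun θ => localRisk s (p θ) t (A k)
  -- Flipping coordinate `k` permutes the cube, so the two halves of the summed two-point bound
  -- coincide.
  have h4 : ∀ k, Fintype.card (K → Bool) * (Δ / 2) ≤ 2 * ∑ θ, localRisk s (p θ) t (A k) := by
    intro k
    rw [two_mul]
    nth_rewrite 2 [← h3 k]
    rw [← Finset.sum_add_distrib]
    calc (Fintype.card (K → Bool) : ℝ≥0∞) * (Δ / 2) = ∑ θ : K → Bool, Δ / 2 := by
          rw [Finset.sum_const, Finset.card_univ, nsmul_eq_mul]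
      _ ≤ _ := Finset.sum_le_sum fun θ _ => h2 k θ
  set c : ℝ≥0∞ := (Fintype.card (K → Bool) : ℝ≥0∞) with hc
  have hc0 : c ≠ 0 := by simp [hc]
  have hct : c ≠ ∞ := by simp [hc]
  have h5 : Fintype.card K * (c * (Δ / 2)) ≤ 2 * (c * S) := by
    calc Fintype.card K * (c * (Δ / 2)) = ∑ k : K, c * (Δ / 2) := by
          rw [Finset.sum_const, Finset.card_univ, nsmul_eq_mul]
      _ ≤ ∑ k, 2 * ∑ θ, localRisk s (p θ) t (A k) := Finset.sum_le_sum fun k _ => h4 k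
      _ = 2 * ∑ θ, ∑ k, localRisk s (p θ) t (A k) := by
          rw [← Finset.mul_sum, Finset.sum_comm]
      _ ≤ 2 * ∑ θ : K → Bool, S := by gcongr with θ; exact h1 θ
      _ = 2 * (c * S) := by rw [Finset.sum_const, Finset.card_univ, nsmul_eq_mul]
  have h6 : Δ / 2 = 2 * (Δ / 4) := by
    rw [div_eq_mul_inv, div_eq_mul_inv, show (4 : ℝ≥0∞) = 2 * 2 by norm_num,
      ENNReal.mul_inv (by simp) (by simp), mul_comm 2, mul_assoc, mul_assoc,
      ENNReal.inv_mul_cancel (by simp) (by simp), mul_one]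
  have h7 : (2 * c) * (Fintype.card K * (Δ / 4)) ≤ (2 * c) * S := by
    calc (2 * c) * (Fintype.card K * (Δ / 4)) = Fintype.card K * (c * (2 * (Δ / 4))) := by ring
      _ ≤ 2 * (c * S) := by rwa [← h6]
      _ = (2 * c) * S := by ring
  exact (ENNReal.mul_le_mul_iff_right (mul_ne_zero (by simp) hc0)
    (ENNReal.mul_ne_top (by simp) hct)).1 h7

end Assouad

/-! ### Fourier transforms of test functions -/

section Fourier

variable {d : ℕ}

local notation "E" => EuclideanSpace ℝ (Fin d)

/-- Integration by parts; taking norms discards the factor `i`. -/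
theorem norm_fourierTr_fderiv {ψ : E → ℝ} (hψ : ContDiff ℝ (⊤ : ℕ∞) ψ) (hc : HasCompactSupport ψ)
    (i : Fin d) (ω : E) :
    ‖fourierTr (fun x => fderiv ℝ ψ x (EuclideanSpace.single i 1)) ω‖
      = |ω i| * ‖fourierTr ψ ω‖ := by
  set v : E := EuclideanSpace.single i 1
  set g : E → ℂ := fun x => Complex.exp (-Complex.I * ((inner ℝ ω x : ℝ) : ℂ)) with hg
  set f : E → ℂ := fun x => (ψ x : ℂ) with hf
  have hfd : ∀ x, HasFDerivAt f (Complex.ofRealCLM.comp (fderiv ℝ ψ x)) x := fun x =>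
    Complex.ofRealCLM.hasFDerivAt.comp x (hψ.differentiable (by simp) x).hasFDerivAt
  have hgd : ∀ x, HasFDerivAt g
      (g x • ((-Complex.I) • Complex.ofRealCLM.comp (innerSL ℝ ω))) x := fun x =>
    ((Complex.ofRealCLM.hasFDerivAt.comp x (innerSL ℝ ω).hasFDerivAt).const_mul
      (-Complex.I)).cexp
  have hfv : ∀ x, fderiv ℝ f x v = ((fderiv ℝ ψ x v : ℝ) : ℂ) := fun x => by
    rw [(hfd x).fderiv]; simp
  have hgv : ∀ x, fderiv ℝ g x v = -Complex.I * (ω i : ℂ) * g x := fun x => by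
    rw [(hgd x).fderiv]
    simp [v, EuclideanSpace.inner_single_right]
    ring
  have hgc : Continuous g := by fun_prop
  have hfc : Continuous f := by have := hψ.continuous; fun_prop
  have hdc : Continuous fun x => fderiv ℝ ψ x v :=
    (hψ.continuous_fderiv (by simp)).clm_apply continuous_const
  have hsf : HasCompactSupport f := hc.comp_left (g := fun r : ℝ => (r : ℂ)) (by simp)
  have hsd : HasCompactSupport fun x => fderiv ℝ ψ x v := hc.fderiv_apply ℝ v
  have hsd' : HasCompactSupport fun x => ((fderiv ℝ ψ x v : ℝ) : ℂ) :=
    hsd.comp_left (g := fun r : ℝ => (r : ℂ)) (by simp)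
  have key := integral_mul_fderiv_eq_neg_fderiv_mul_of_integrable (μ := (volume : Measure E))
    (f := f) (g := g) (v := v) ?_ ?_ ?_ (fun x _ => (hfd x).differentiableAt)
    (fun x _ => (hgd x).differentiableAt)
  · simp_rw [hfv, hgv] at key
    have h1 : fourierTr (fun x => fderiv ℝ ψ x v) ω = Complex.I * ω i * fourierTr ψ ω := by
      unfold fourierTr
      rw [← neg_eq_iff_eq_neg.2 key, ← integral_const_mul, ← integral_neg]
      congr 1; ext x
      simp only [hf, hg]; ring
    rw [h1]
    simp
  · simp_rw [hfv]
    exact ((Complex.continuous_ofReal.comp hdc).mul hgc).integrable_of_hasCompactSupport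
      hsd'.mul_right
  · simp_rw [hgv]
    exact (hfc.mul (continuous_const.mul hgc)).integrable_of_hasCompactSupport hsf.mul_right
  · exact (hfc.mul hgc).integrable_of_hasCompactSupport hsf.mul_right

/-- Every monomial multiple of the Fourier transform of a test function is, up to a unimodular
factor, the Fourier transform of a test function with smaller support. -/
theorem exists_norm_fourierTr_eq_monomial {φ : E → ℝ} (hφ : ContDiff ℝ (⊤ : ℕ∞) φ)
    (hc : HasCompactSupport φ) (α : Fin d → ℕ) :
    ∃ ψ : E → ℝ, ContDiff ℝ (⊤ : ℕ∞) ψ ∧ tsupport ψ ⊆ tsupport φ ∧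
      ∀ ω, ‖fourierTr ψ ω‖ = |∏ i, ω i ^ α i| * ‖fourierTr φ ω‖ := by
  have main : ∀ s : Finset (Fin d), ∃ ψ : E → ℝ, ContDiff ℝ (⊤ : ℕ∞) ψ ∧
      tsupport ψ ⊆ tsupport φ ∧ ∀ ω, ‖fourierTr ψ ω‖ = |∏ i ∈ s, ω i ^ α i| * ‖fourierTr φ ω‖ := by
    intro s
    induction s using Finset.induction_on with
    | empty => exact ⟨φ, hφ, le_rfl, by simp⟩
    | insert i s hi ih =>
      have step : ∀ k : ℕ, ∃ ψ : E → ℝ, ContDiff ℝ (⊤ : ℕ∞) ψ ∧ tsupport ψ ⊆ tsupport φ ∧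
          ∀ ω, ‖fourierTr ψ ω‖ = |ω i ^ k * ∏ i ∈ s, ω i ^ α i| * ‖fourierTr φ ω‖ := by
        intro k
        induction k with
        | zero => simpa using ih
        | succ k ihk =>
          obtain ⟨ψ, h1, h2, h3⟩ := ihk
          refine ⟨fun x => fderiv ℝ ψ x (EuclideanSpace.single i 1), ?_,
            (tsupport_fderiv_apply_subset ℝ _).trans h2, fun ω => ?_⟩
          · exact (h1.fderiv_right (m := ((⊤ : ℕ∞) : WithTop ℕ∞)) (by simp)).clm_apply contDiff_const
          · rw [norm_fourierTr_fderiv h1 (hc.mono' (subset_tsupport _ |>.trans h2)), h3, ← mul_assoc,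
              ← abs_mul, pow_succ']
            congr 2; ring
      obtain ⟨ψ, h1, h2, h3⟩ := step (α i)
      exact ⟨ψ, h1, h2, fun ω => by rw [h3, Finset.prod_insert hi]⟩
  exact main Finset.univ

/-- Plancherel for Schwartz functions. The factor `(2 π) ^ d` comes from rescaling the frequency
between the two conventions. -/
theorem lintegral_fourierTr_sq {ψ : E → ℝ} (hψ : ContDiff ℝ (⊤ : ℕ∞) ψ)
    (hc : HasCompactSupport ψ) :
    ∫⁻ ω, ENNReal.ofReal (‖fourierTr ψ ω‖ ^ 2)
      = ENNReal.ofReal ((2 * π) ^ d * ∫ x, ψ x ^ 2) := by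
  have hs : HasCompactSupport fun x => (ψ x : ℂ) :=
    hc.comp_left (g := fun r : ℝ => (r : ℂ)) (by simp)
  have hd : ContDiff ℝ (⊤ : ℕ∞) fun x => (ψ x : ℂ) := Complex.ofRealCLM.contDiff.comp hψ
  set Ψ : SchwartzMap E ℂ := hs.toSchwartzMap hd with hΨ
  have h1 : ∀ ω, fourierTr ψ ω = FourierTransform.fourier Ψ ((2 * π)⁻¹ • ω) := by
    intro ω
    rw [SchwartzMap.fourier_coe, Real.fourier_eq']
    unfold fourierTr
    congr 1; ext x
    rw [smul_eq_mul, mul_comm]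
    congr 2
    rw [inner_smul_right, real_inner_comm]
    push_cast
    have : (π : ℂ) ≠ 0 := by exact_mod_cast pi_ne_zero
    field_simp
  have h2 := SchwartzMap.integral_norm_sq_fourier Ψ
  have h3 : Integrable fun ξ => ‖FourierTransform.fourier Ψ ξ‖ ^ 2 :=
    ((FourierTransform.fourier Ψ).memLp 2 volume).integrable_norm_pow (by simp)
  simp_rw [h1]
  rw [← ofReal_integral_eq_lintegral_ofReal (h3.comp_smul (by positivity))
    (.of_forall fun ω => by positivity),
    Measure.integral_comp_inv_smul_of_nonneg volume
      (fun ξ => ‖FourierTransform.fourier Ψ ξ‖ ^ 2) (by positivity), h2]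
  simp [hΨ, sq_abs]

end Fourier

/-! ### Sums of disjoint bumps and their Sobolev energy -/

section BumpSum

variable {d : ℕ} {J : Type*} [Fintype J]

local notation "E" => EuclideanSpace ℝ (Fin d)

/-- A sum of rescaled translates of `ψ`, of height `a`, width `s` and centres `c j`. -/
noncomputable def bumpSum (ψ : E → ℝ) (a s : ℝ) (c : J → E) (x : E) : ℝ :=
  ∑ j, a * ψ (s⁻¹ • (x - c j))

theorem eq_zero_of_tsupport_subset {ψ : E → ℝ} (hψ : tsupport ψ ⊆ Metric.closedBall 0 1) {s : ℝ}
    (hs : 0 < s) {x c : E} (hx : s < dist x c) : ψ (s⁻¹ • (x - c)) = 0 := by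
  refine image_eq_zero_of_notMem_tsupport fun h => ?_
  have h1 := hψ h
  rw [mem_closedBall_zero_iff, norm_smul, norm_inv, Real.norm_of_nonneg hs.le, ← dist_eq_norm,
    inv_mul_le_iff₀ hs] at h1
  linarith

theorem contDiff_bumpSum {ψ : E → ℝ} (hψ : ContDiff ℝ (⊤ : ℕ∞) ψ) (a s : ℝ) (c : J → E) :
    ContDiff ℝ (⊤ : ℕ∞) (bumpSum ψ a s c) := by
  refine ContDiff.sum fun j _ => contDiff_const.mul (hψ.comp ?_)
  fun_prop

theorem hasCompactSupport_bumpSum {ψ : E → ℝ} (hψ : tsupport ψ ⊆ Metric.closedBall 0 1) (a : ℝ)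
    {s : ℝ} (hs : 0 < s) (c : J → E) : HasCompactSupport (bumpSum ψ a s c) := by
  refine HasCompactSupport.intro (K := ⋃ j, Metric.closedBall (c j) s)
    (isCompact_iUnion fun j => isCompact_closedBall _ _) fun x hx => ?_
  refine Finset.sum_eq_zero fun j _ => ?_
  rw [Set.mem_iUnion, not_exists] at hx
  rw [eq_zero_of_tsupport_subset hψ hs (lt_of_not_ge (hx j)), mul_zero]

theorem integrable_comp_inv_smul_sub {F : Type*} [NormedAddCommGroup F] {f : E → F}
    (hf : Integrable f) {s : ℝ} (hs : 0 < s) (c : E) :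
    Integrable fun x => f (s⁻¹ • (x - c)) :=
  (hf.comp_smul (inv_ne_zero hs.ne')).comp_sub_right c

theorem integral_comp_inv_smul_sub {F : Type*} [NormedAddCommGroup F] [NormedSpace ℝ F] (f : E → F)
    {s : ℝ} (hs : 0 < s) (c : E) : ∫ x, f (s⁻¹ • (x - c)) = s ^ d • ∫ x, f x := by
  rw [integral_sub_right_eq_self (fun x => f (s⁻¹ • x)) c,
    Measure.integral_comp_inv_smul_of_nonneg volume f hs.le]
  simp

theorem integrable_bumpSum {ψ : E → ℝ} (hψ : Integrable ψ) (a : ℝ) {s : ℝ} (hs : 0 < s)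
    (c : J → E) : Integrable (bumpSum ψ a s c) :=
  integrable_finsetSum _ fun j _ => (integrable_comp_inv_smul_sub hψ hs (c j)).const_mul a

theorem integral_bumpSum {ψ : E → ℝ} (hψ : Integrable ψ) (a : ℝ) {s : ℝ} (hs : 0 < s)
    (c : J → E) : ∫ x, bumpSum ψ a s c x = Fintype.card J * (a * s ^ d * ∫ x, ψ x) := by
  unfold bumpSum
  rw [integral_finsetSum _ fun j _ => (integrable_comp_inv_smul_sub hψ hs (c j)).const_mul a]
  simp_rw [integral_const_mul, integral_comp_inv_smul_sub ψ hs]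
  simp [mul_assoc]

/-- Cross terms vanish because the supports are disjoint. -/
theorem bumpSum_sq {ψ : E → ℝ} (hψ : tsupport ψ ⊆ Metric.closedBall 0 1) (a : ℝ) {s : ℝ}
    (hs : 0 < s) {c : J → E} (hc : ∀ i j, i ≠ j → 2 * s < dist (c i) (c j)) (x : E) :
    bumpSum ψ a s c x ^ 2 = bumpSum (fun y => ψ y ^ 2) (a ^ 2) s c x := by
  unfold bumpSum
  rw [sq, Finset.sum_mul_sum]
  refine Finset.sum_congr rfl fun i _ => ?_
  rw [Finset.sum_eq_single i]
  · ring
  · intro j _ hij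
    by_cases hi : s < dist x (c i)
    · rw [eq_zero_of_tsupport_subset hψ hs hi]; ring
    · have hj : s < dist x (c j) := by
        have h1 := hc i j hij.symm
        have h2 := dist_triangle_left (c i) (c j) x
        linarith
      rw [eq_zero_of_tsupport_subset hψ hs hj]; ring
  · simp

/-- The exponential sum depends on the centres only, not on the profile; profiles can therefore be
exchanged under it. -/
theorem fourierTr_bumpSum {ψ : E → ℝ} (hψ : Integrable ψ) (a : ℝ) {s : ℝ} (hs : 0 < s)
    (c : J → E) (ω : E) :
    fourierTr (bumpSum ψ a s c) ω = a * s ^ d * fourierTr ψ (s • ω)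
      * ∑ j, Complex.exp (-Complex.I * ((inner ℝ ω (c j) : ℝ) : ℂ)) := by
  set G : E → ℂ := fun y => (ψ y : ℂ) * Complex.exp (-Complex.I * ((inner ℝ (s • ω) y : ℝ) : ℂ))
  have hG : Integrable G := by
    refine (hψ.ofReal (𝕜 := ℂ)).mul_bdd (c := 1) (Continuous.aestronglyMeasurable (by fun_prop))
      (.of_forall fun y => ?_)
    rw [Complex.norm_exp]; simp
  have h1 : ∀ x, (bumpSum ψ a s c x : ℂ) * Complex.exp (-Complex.I * ((inner ℝ ω x : ℝ) : ℂ))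
      = ∑ j, (a * Complex.exp (-Complex.I * ((inner ℝ ω (c j) : ℝ) : ℂ)))
        * G (s⁻¹ • (x - c j)) := by
    intro x
    unfold bumpSum
    push_cast
    rw [Finset.sum_mul]
    refine Finset.sum_congr rfl fun j _ => ?_
    have h2 : inner ℝ (s • ω) (s⁻¹ • (x - c j)) = inner ℝ ω x - inner ℝ ω (c j) := by
      rw [inner_smul_left, inner_smul_right, inner_sub_right]
      simp [hs.ne']
    have h3 : Complex.exp (-Complex.I * ((inner ℝ ω x : ℝ) : ℂ))
        = Complex.exp (-Complex.I * ((inner ℝ ω (c j) : ℝ) : ℂ))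
          * Complex.exp (-Complex.I * ((inner ℝ ω x - inner ℝ ω (c j) : ℝ) : ℂ)) := by
      rw [← Complex.exp_add]; congr 1; push_cast; ring
    simp only [G, h2]
    rw [h3]
    ring
  unfold fourierTr
  simp_rw [h1]
  rw [integral_finsetSum _ fun j _ => (integrable_comp_inv_smul_sub hG hs (c j)).const_mul _]
  simp_rw [integral_const_mul, integral_comp_inv_smul_sub G hs]
  rw [Finset.mul_sum]
  refine Finset.sum_congr rfl fun j _ => ?_
  simp only [G, Complex.real_smul]
  push_cast
  ring

/-- The Sobolev energy of a sum of disjoint bumps. -/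
theorem lintegral_monomial_fourierTr_bumpSum {φ ψ : E → ℝ} (hφ : Integrable φ)
    (hψ : ContDiff ℝ (⊤ : ℕ∞) ψ) (hsupp : tsupport ψ ⊆ Metric.closedBall 0 1) {α : Fin d → ℕ}
    (h : ∀ ω, ‖fourierTr ψ ω‖ = |∏ i, ω i ^ α i| * ‖fourierTr φ ω‖) (a : ℝ) {s : ℝ}
    (hs : 0 < s) {c : J → E} (hc : ∀ i j, i ≠ j → 2 * s < dist (c i) (c j)) :
    ∫⁻ ω : E, ENNReal.ofReal (|∏ i, ω i ^ α i| ^ 2 * ‖fourierTr (bumpSum φ a s c) ω‖ ^ 2)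
      = ENNReal.ofReal ((2 * π) ^ d * (∫ x, ψ x ^ 2)
          * (Fintype.card J * (a ^ 2 * s ^ d * ((s ^ ∑ i, α i)⁻¹) ^ 2))) := by
  have hcs : HasCompactSupport ψ := (isCompact_closedBall (0 : E) 1).of_isClosed_subset
    (isClosed_tsupport ψ) hsupp
  have hψi : Integrable ψ := hψ.continuous.integrable_of_hasCompactSupport hcs
  have hψ2 : Integrable fun x => ψ x ^ 2 := by
    have h0 : HasCompactSupport fun x => ψ x ^ 2 := by
      simp_rw [sq]; exact hcs.mul_left
    exact (hψ.continuous.pow 2).integrable_of_hasCompactSupport h0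
  -- The monomial is absorbed by replacing the profile `φ` with `ψ`, at the cost of `s ^ (-|α|)`.
  -- Plancherel then applies to bumps that are still disjoint.
  have h1 : ∀ ω : E, |∏ i, ω i ^ α i| ^ 2 * ‖fourierTr (bumpSum φ a s c) ω‖ ^ 2
      = ((s ^ ∑ i, α i)⁻¹) ^ 2 * ‖fourierTr (bumpSum ψ a s c) ω‖ ^ 2 := by
    intro ω
    rw [fourierTr_bumpSum hφ a hs, fourierTr_bumpSum hψi a hs]
    simp only [norm_mul, h]
    have h2 : ∏ i, (s • ω) i ^ α i = s ^ (∑ i, α i) * ∏ i, ω i ^ α i := by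
      simp [mul_pow, Finset.prod_mul_distrib, Finset.prod_pow_eq_pow_sum]
    rw [h2, abs_mul, abs_of_pos (pow_pos hs _)]
    have : s ^ (∑ i, α i) ≠ 0 := (pow_pos hs _).ne'
    field_simp
  simp_rw [h1]
  simp_rw [ENNReal.ofReal_mul (sq_nonneg ((s ^ ∑ i, α i)⁻¹))]
  rw [lintegral_const_mul' _ _ ENNReal.ofReal_ne_top,
    lintegral_fourierTr_sq (contDiff_bumpSum hψ a s c) (hasCompactSupport_bumpSum hsupp a hs c),
    ← ENNReal.ofReal_mul (sq_nonneg _)]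
  simp_rw [bumpSum_sq hsupp a hs hc]
  rw [integral_bumpSum hψ2 _ hs]
  congr 1; ring

end BumpSum

/-! ### Separation of scores when one bump moves -/

section Separation

variable {d : ℕ}

local notation "E" => EuclideanSpace ℝ (Fin d)

theorem gaussKernel_sq {s : ℝ} (hs : 0 < s) (z : E) :
    gaussKernel (s ^ 2) z
      = (1 / (2 * π) ^ ((d : ℝ) / 2)) * (s ^ d)⁻¹ * exp (-(‖z‖ / s) ^ 2 / 2) := by
  unfold gaussKernel
  have h1 : (2 * π * s ^ 2) ^ ((d : ℝ) / 2) = (2 * π) ^ ((d : ℝ) / 2) * s ^ d := by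
    rw [mul_rpow (by positivity) (by positivity), ← rpow_natCast s 2, ← rpow_mul hs.le,
      ← rpow_natCast s d]
    congr 2; push_cast; ring
  have h2 : -‖z‖ ^ 2 / (2 * s ^ 2) = -(‖z‖ / s) ^ 2 / 2 := by
    field_simp
  rw [h1, h2]
  field_simp

/-- The bump lies within `s` of `c`, hence within `(A + 1) s` of `x`. The factor `s ^ (-d)` of the
kernel cancels the `s ^ d` in the mass. The upper bound `smoothed_bump_le` is the same computation
with least distance `A s`. -/
theorem le_smoothed_bump {φ : E → ℝ} (hφ : Integrable φ) (h0 : ∀ x, 0 ≤ φ x)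
    (hsupp : tsupport φ ⊆ Metric.closedBall 0 1) {s a A : ℝ} (hs : 0 < s) (ha : 0 < a)
    {x c : E} (hx : dist x c ≤ A * s) :
    a * ((1 / (2 * π) ^ ((d : ℝ) / 2)) * (∫ y, φ y) * exp (-(A + 1) ^ 2 / 2))
      ≤ smoothed (fun y => a * φ (s⁻¹ • (y - c))) (s ^ 2) x := by
  have hi := (integrable_comp_inv_smul_sub hφ hs c).const_mul a
  set B : ℝ := (1 / (2 * π) ^ ((d : ℝ) / 2)) * (s ^ d)⁻¹ * exp (-(A + 1) ^ 2 / 2) with hB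
  have h1 : ∫ y, B * (a * φ (s⁻¹ • (y - c)))
      = a * ((1 / (2 * π) ^ ((d : ℝ) / 2)) * (∫ y, φ y) * exp (-(A + 1) ^ 2 / 2)) := by
    rw [integral_const_mul, integral_const_mul, integral_comp_inv_smul_sub φ hs, smul_eq_mul, hB]
    field_simp
  rw [← h1]
  refine integral_mono (hi.const_mul B) (integrable_gaussKernel_mul hi (by positivity) x)
    fun y => ?_
  by_cases hy : s < dist y c
  · simp [eq_zero_of_tsupport_subset hsupp hs hy]
  · have h2 : B ≤ gaussKernel (s ^ 2) (x - y) := by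
      rw [gaussKernel_sq hs, hB]
      have h3 : ‖x - y‖ / s ≤ A + 1 := by
        rw [div_le_iff₀ hs, ← dist_eq_norm]
        linarith [dist_triangle_right x y c]
      gcongr
    exact mul_le_mul_of_nonneg_right h2 (mul_nonneg ha.le (h0 _))

theorem smoothed_bump_le {φ : E → ℝ} (hφ : Integrable φ) (h0 : ∀ x, 0 ≤ φ x)
    (hsupp : tsupport φ ⊆ Metric.closedBall 0 1) {s a A : ℝ} (hs : 0 < s) (ha : 0 < a)
    (hA : 0 ≤ A) {x c : E} (hx : (A + 1) * s ≤ dist x c) :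
    smoothed (fun y => a * φ (s⁻¹ • (y - c))) (s ^ 2) x
      ≤ a * ((1 / (2 * π) ^ ((d : ℝ) / 2)) * (∫ y, φ y) * exp (-A ^ 2 / 2)) := by
  have hi := (integrable_comp_inv_smul_sub hφ hs c).const_mul a
  set B : ℝ := (1 / (2 * π) ^ ((d : ℝ) / 2)) * (s ^ d)⁻¹ * exp (-A ^ 2 / 2) with hB
  have h1 : ∫ y, B * (a * φ (s⁻¹ • (y - c)))
      = a * ((1 / (2 * π) ^ ((d : ℝ) / 2)) * (∫ y, φ y) * exp (-A ^ 2 / 2)) := by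
    rw [integral_const_mul, integral_const_mul, integral_comp_inv_smul_sub φ hs, smul_eq_mul, hB]
    field_simp
  rw [← h1]
  refine integral_mono (integrable_gaussKernel_mul hi (by positivity) x) (hi.const_mul B)
    fun y => ?_
  by_cases hy : s < dist y c
  · simp [eq_zero_of_tsupport_subset hsupp hs hy]
  · have h2 : gaussKernel (s ^ 2) (x - y) ≤ B := by
      rw [gaussKernel_sq hs, hB]
      have h3 : A ≤ ‖x - y‖ / s := by
        rw [le_div_iff₀ hs, ← dist_eq_norm]
        linarith [dist_triangle x y c]
      gcongr
    exact mul_le_mul_of_nonneg_right h2 (mul_nonneg ha.le (h0 _))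

/-- The ratio `(u + a α) / (u + a α')` decreases in the background `u`; at the worst case `u = U a`
the height `a` cancels. -/
theorem log_sub_log_ge {u v w a U α α' : ℝ} (hU : 0 ≤ U) (hα' : 0 < α') (hα : α' < α)
    (hu : 0 ≤ u) (huU : u ≤ U * a) (hv : a * α ≤ v) (hw0 : 0 < w) (hw : w ≤ a * α') :
    log ((U + α) / (U + α')) ≤ log (u + v) - log (u + w) := by
  have h1 : 0 < u + w := by linarith
  have h2 : 0 < U + α' := by linarith
  have h3 : 0 < U + α := by linarith
  rw [le_sub_iff_add_le, ← log_mul (div_pos h3 h2).ne' h1.ne']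
  refine log_le_log (by positivity) ?_
  rw [div_mul_eq_mul_div, div_le_iff₀ h2]
  have h4 : (U + α) * (u + w) ≤ (U + α) * (u + a * α') := by gcongr
  have h5 : (u + a * α) * (U + α') ≤ (u + v) * (U + α') := by gcongr
  have h6 : 0 ≤ (U * a - u) * (α - α') := mul_nonneg (by linarith) (by linarith)
  nlinarith

theorem half_norm_sub_sq_le {F : Type*} [NormedAddCommGroup F] (f p q : F) :
    ‖p - q‖ ^ 2 / 2 ≤ ‖f - p‖ ^ 2 + ‖f - q‖ ^ 2 := by
  have h1 : ‖p - q‖ ≤ ‖f - p‖ + ‖f - q‖ := by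
    rw [norm_sub_rev f p, ← sub_add_sub_cancel p f q]; exact norm_add_le _ _
  have h2 : ‖p - q‖ ^ 2 ≤ (‖f - p‖ + ‖f - q‖) ^ 2 := by gcongr
  nlinarith [sq_nonneg (‖f - p‖ - ‖f - q‖)]

/-- Moving a bump of comparable height to the background by a distance of order `√t` changes the
score at time `t` by an amount of order `1 / √t`. -/
theorem exists_separation_bump {φ : E → ℝ} (hφ : Integrable φ) (h0 : ∀ x, 0 ≤ φ x)
    (hI : 0 < ∫ x, φ x) (hsupp : tsupport φ ⊆ Metric.closedBall 0 1) {U : ℝ} (hU : 0 ≤ U) :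
    ∃ c₁ : ℝ, 0 < c₁ ∧ ∀ (s a : ℝ) (W : E → ℝ) (x₀ v : E), 0 < s → 0 < a → Integrable W →
      (∀ x, 0 ≤ W x) → ‖v‖ = s → (∀ x ∈ Metric.ball x₀ (3 * s), smoothed W (s ^ 2) x ≤ U * a) →
      ∀ p q : E → ℝ, (p = fun y => W y + a * φ (s⁻¹ • (y - (x₀ + (2 : ℝ) • v)))) →
        (q = fun y => W y + a * φ (s⁻¹ • (y - (x₀ + (-2 : ℝ) • v)))) → ∀ f : E → E, Measurable f →
        ENNReal.ofReal (c₁ * (a * s ^ d / s ^ 2)) ≤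
          (∫⁻ x in Metric.ball x₀ (3 * s),
            ENNReal.ofReal (‖f x - score p (s ^ 2) x‖ ^ 2 * smoothed p (s ^ 2) x))
          + ∫⁻ x in Metric.ball x₀ (3 * s),
            ENNReal.ofReal (‖f x - score q (s ^ 2) x‖ ^ 2 * smoothed q (s ^ 2) x) := by
  set I := ∫ x, φ x with hIdef
  set j : ℝ := (1 / (2 * π) ^ ((d : ℝ) / 2)) * I with hj
  have hjpos : 0 < j := by positivity
  -- An endpoint of a segment is within `s / 2` of the near bump centre and at least `4 s - s / 2 =
  -- (5 / 2 + 1) s` from the far one. These distances give `α` and `α'`.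
  set α : ℝ := j * exp (-(1 / 2 + 1) ^ 2 / 2) with hα
  set α' : ℝ := j * exp (-(5 / 2) ^ 2 / 2) with hα'
  have hα'pos : 0 < α' := by positivity
  have hαα' : α' < α := by
    refine mul_lt_mul_of_pos_left (exp_lt_exp.2 (by norm_num)) hjpos
  set κ : ℝ := log ((U + α) / (U + α')) with hκ
  have hκpos : 0 < κ := log_pos ((one_lt_div (by linarith)).2 (by linarith))
  -- Every point of the ball of radius `3 s` is within `5 s` of both possible centres, so both
  -- smoothed densities are at least `a m` there.
  set m : ℝ := j * exp (-(5 + 1) ^ 2 / 2) with hm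
  have hmpos : 0 < m := by positivity
  set ω : ℝ := (volume (Metric.ball (0 : E) 1)).toReal with hω
  have hωpos : 0 < ω := ENNReal.toReal_pos (Metric.measure_ball_pos _ _ one_pos).ne'
    measure_ball_lt_top.ne
  refine ⟨m / 2 * ((2 * κ) ^ 2 / 16) * (1 / 2) ^ d * ω, by positivity, ?_⟩
  intro s a W x₀ v hs ha hW hW0 hv hWU p q hp hq f hf
  have ht : 0 < s ^ 2 := by positivity
  set bp : E → ℝ := fun y => a * φ (s⁻¹ • (y - (x₀ + (2 : ℝ) • v))) with hbp
  set bq : E → ℝ := fun y => a * φ (s⁻¹ • (y - (x₀ + (-2 : ℝ) • v))) with hbq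
  have hbpi : Integrable bp := (integrable_comp_inv_smul_sub hφ hs _).const_mul a
  have hbqi : Integrable bq := (integrable_comp_inv_smul_sub hφ hs _).const_mul a
  have hmass : ∀ c : E, 0 < ∫ y, a * φ (s⁻¹ • (y - c)) := fun c => by
    rw [integral_const_mul, integral_comp_inv_smul_sub φ hs, smul_eq_mul]; positivity
  have hpi : Integrable p := hp ▸ hW.add hbpi
  have hqi : Integrable q := hq ▸ hW.add hbqi
  have hp0 : ∀ x, 0 ≤ p x := fun x => hp ▸ add_nonneg (hW0 x) (mul_nonneg ha.le (h0 _))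
  have hq0 : ∀ x, 0 ≤ q x := fun x => hq ▸ add_nonneg (hW0 x) (mul_nonneg ha.le (h0 _))
  have hp1 : 0 < ∫ x, p x := by
    rw [hp, integral_add hW hbpi]
    exact add_pos_of_nonneg_of_pos (integral_nonneg hW0) (hmass _)
  have hq1 : 0 < ∫ x, q x := by
    rw [hq, integral_add hW hbqi]
    exact add_pos_of_nonneg_of_pos (integral_nonneg hW0) (hmass _)
  have hsp : ∀ x, smoothed p (s ^ 2) x = smoothed W (s ^ 2) x + smoothed bp (s ^ 2) x := fun x => by
    rw [hp]; exact smoothed_add hW hbpi ht x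
  have hsq : ∀ x, smoothed q (s ^ 2) x = smoothed W (s ^ 2) x + smoothed bq (s ^ 2) x := fun x => by
    rw [hq]; exact smoothed_add hW hbqi ht x
  have hlp := contDiff_log_smoothed hpi hp0 hp1 ht
  have hlq := contDiff_log_smoothed hqi hq0 hq1 ht
  have hW0' := smoothed_nonneg hW0 ht
  have hbp0 : ∀ x, 0 < smoothed bp (s ^ 2) x :=
    smoothed_pos hbpi (fun y => mul_nonneg ha.le (h0 _)) (hmass _) ht
  have hbq0 : ∀ x, 0 < smoothed bq (s ^ 2) x :=
    smoothed_pos hbqi (fun y => mul_nonneg ha.le (h0 _)) (hmass _) ht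
  have hnorm2 : ∀ r : ℝ, ‖r • v‖ = |r| * s := fun r => by rw [norm_smul, hv, Real.norm_eq_abs]
  -- The log ratio is at least `κ` at the forward end and at most `-κ` at the backward end, hence
  -- the increment `2 κ`.
  have energy := lintegral_fderiv_sq_ball_ge (hlp.sub hlq) (v := v) (x₀ := x₀) (σ := s)
    (κ := 2 * κ) hs (by positivity) hv ?_
  · have hvol : volume (Metric.ball x₀ (s / 2))
        = ENNReal.ofReal ((1 / 2) ^ d * s ^ d * ω) := by
      rw [Measure.addHaar_ball_of_pos volume x₀ (by positivity), ENNReal.ofReal_mul (by positivity),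
        hω, ENNReal.ofReal_toReal measure_ball_lt_top.ne]
      congr 2
      simp [div_eq_mul_inv, mul_pow, mul_comm]
    rw [hvol, ← ENNReal.ofReal_mul (by positivity)] at energy
    have hlow : ∀ x ∈ Metric.ball x₀ (3 * s), a * m ≤ smoothed p (s ^ 2) x ∧
        a * m ≤ smoothed q (s ^ 2) x := by
      intro x hx
      rw [Metric.mem_ball] at hx
      have hd : ∀ r : ℝ, |r| ≤ 2 → dist x (x₀ + r • v) ≤ 5 * s := fun r hr => by
        have h1 := dist_triangle x x₀ (x₀ + r • v)
        have h2 : dist x₀ (x₀ + r • v) ≤ 2 * s := by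
          rw [dist_self_add_right, hnorm2]; gcongr
        linarith
      have h2 : a * m ≤ smoothed bp (s ^ 2) x :=
        le_smoothed_bump hφ h0 hsupp hs ha (hd 2 (by norm_num))
      have h3 : a * m ≤ smoothed bq (s ^ 2) x :=
        le_smoothed_bump hφ h0 hsupp hs ha (hd (-2) (by norm_num))
      rw [hsp, hsq]
      exact ⟨by linarith [hW0' x], by linarith [hW0' x]⟩
    have hpt : ∀ x ∈ Metric.ball x₀ (3 * s), ENNReal.ofReal (a * m / 2) * ENNReal.ofReal
        (‖fderiv ℝ (fun x => log (smoothed p (s ^ 2) x) - log (smoothed q (s ^ 2) x)) x‖ ^ 2)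
        ≤ ENNReal.ofReal (‖f x - score p (s ^ 2) x‖ ^ 2 * smoothed p (s ^ 2) x)
          + ENNReal.ofReal (‖f x - score q (s ^ 2) x‖ ^ 2 * smoothed q (s ^ 2) x) := by
      intro x hx
      obtain ⟨h1, h2⟩ := hlow x hx
      have ham : 0 ≤ a * m := by positivity
      rw [← norm_score_sub_score (hlp.differentiable (by simp) x) (hlq.differentiable (by simp) x),
        ← ENNReal.ofReal_mul (by positivity), ← ENNReal.ofReal_add
        (mul_nonneg (sq_nonneg _) (ham.trans h1)) (mul_nonneg (sq_nonneg _) (ham.trans h2))]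
      refine ENNReal.ofReal_le_ofReal ?_
      calc a * m / 2 * ‖score p (s ^ 2) x - score q (s ^ 2) x‖ ^ 2
          = (‖score p (s ^ 2) x - score q (s ^ 2) x‖ ^ 2 / 2) * (a * m) := by ring
        _ ≤ (‖f x - score p (s ^ 2) x‖ ^ 2 + ‖f x - score q (s ^ 2) x‖ ^ 2) * (a * m) := by
          gcongr; exact half_norm_sub_sq_le _ _ _
        _ = ‖f x - score p (s ^ 2) x‖ ^ 2 * (a * m) + ‖f x - score q (s ^ 2) x‖ ^ 2 * (a * m) := by
          ring
        _ ≤ _ := by gcongr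
    rw [← lintegral_add_left]
    · refine le_trans ?_ (setLIntegral_mono' measurableSet_ball hpt)
      rw [lintegral_const_mul' _ _ ENNReal.ofReal_ne_top]
      refine le_trans (le_of_eq ?_) (mul_le_mul_right energy _)
      rw [← ENNReal.ofReal_mul (by positivity)]
      congr 1
      field_simp
    · exact (((hf.sub (measurable_score p _)).norm.pow_const 2).mul
        (contDiff_smoothed hpi ht).continuous.measurable).ennreal_ofReal
  · intro y hy
    rw [Metric.mem_ball] at hy
    have hin : ∀ r : ℝ, |r| = 2 → y + r • v ∈ Metric.ball x₀ (3 * s) := fun r hr => by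
      rw [Metric.mem_ball]
      have h1 := dist_triangle (y + r • v) y x₀
      rw [dist_self_add_left, hnorm2, hr] at h1
      linarith
    have hnear : ∀ r : ℝ, dist (y + r • v) (x₀ + r • v) ≤ 1 / 2 * s := fun r => by
      rw [dist_add_right]; linarith
    have hfar : ∀ r r' : ℝ, |r - r'| = 4 →
        (5 / 2 + 1) * s ≤ dist (y + r • v) (x₀ + r' • v) := fun r r' hr => by
      have h1 : dist (x₀ + r • v) (x₀ + r' • v) = 4 * s := by
        rw [dist_add_left, dist_eq_norm, ← sub_smul, hnorm2, hr]
      have h2 := dist_triangle_left (x₀ + r • v) (x₀ + r' • v) (y + r • v)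
      linarith [hnear r]
    have h1 := le_smoothed_bump hφ h0 hsupp hs ha (hnear 2)
    have h2 := smoothed_bump_le hφ h0 hsupp hs ha (by norm_num) (hfar 2 (-2) (by norm_num))
    have h3 := le_smoothed_bump hφ h0 hsupp hs ha (hnear (-2))
    have h4 := smoothed_bump_le hφ h0 hsupp hs ha (by norm_num) (hfar (-2) 2 (by norm_num))
    have h5 := log_sub_log_ge hU hα'pos hαα' (hW0' _) (hWU _ (hin 2 (by norm_num))) h1
      (hbq0 _) h2
    have h6 := log_sub_log_ge hU hα'pos hαα' (hW0' _) (hWU _ (hin (-2) (by norm_num))) h3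
      (hbp0 _) h4
    rw [← hsp, ← hsq] at h5
    rw [← hsp, ← hsq] at h6
    linarith

end Separation

/-! ### Tails of smoothed densities -/

section Tails

variable {d : ℕ}

local notation "E" => EuclideanSpace ℝ (Fin d)

theorem integral_gaussKernel {t : ℝ} (ht : 0 < t) : ∫ x : E, gaussKernel t x = 1 := by
  have h := GaussianFourier.integral_rexp_neg_mul_sq_norm (V := E) (b := 1 / (2 * t)) (by positivity)
  unfold gaussKernel
  rw [integral_const_mul]
  have h1 : ∀ x : E, -‖x‖ ^ 2 / (2 * t) = -(1 / (2 * t)) * ‖x‖ ^ 2 := fun x => by ring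
  simp_rw [h1]
  rw [h]
  have h2 : π / (1 / (2 * t)) = 2 * π * t := by field_simp
  rw [h2]
  simp only [finrank_euclideanSpace, Fintype.card_fin]
  exact one_div_mul_cancel (by positivity)

theorem integrable_gaussKernel {t : ℝ} (ht : 0 < t) : Integrable (gaussKernel t : E → ℝ) :=
  .of_integral_ne_zero (by rw [integral_gaussKernel ht]; norm_num)

theorem smoothed_le_of_le {p : E → ℝ} (hp : Integrable p) {t A : ℝ} (ht : 0 < t)
    (h : ∀ x, p x ≤ A) (x : E) : smoothed p t x ≤ A := by
  have hg : Integrable fun y => gaussKernel t (x - y) := (integrable_gaussKernel ht).comp_sub_left x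
  calc smoothed p t x ≤ ∫ y, gaussKernel t (x - y) * A :=
        integral_mono (integrable_gaussKernel_mul hp ht x) (hg.mul_const A) fun y =>
          mul_le_mul_of_nonneg_left (h y) (gaussKernel_pos ht _).le
    _ = A := by
      rw [integral_mul_const, integral_sub_left_eq_self (fun y => gaussKernel t y) volume x,
        integral_gaussKernel ht, one_mul]

/-- Uses `log y ≤ y` and `T y ≤ y ^ 2 / 8 + 2 T ^ 2`. -/
theorem exp_neg_sq_le_rpow {y T : ℝ} (hy : 0 < y) (hT : 0 ≤ T) :
    exp (-(y / 2) ^ 2 / 2) ≤ exp (2 * T ^ 2) * y ^ (-T) := by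
  rw [rpow_def_of_pos hy, ← exp_add]
  refine exp_le_exp.2 ?_
  have h1 : log y ≤ y := (log_le_sub_one_of_pos hy).trans (by linarith)
  have h2 : log y * T ≤ y * T := by gcongr
  nlinarith [sq_nonneg (y - 4 * T)]

/-- Smoothing at a bounded noise level preserves polynomial tails. -/
theorem exists_smoothed_tail_le {γ C : ℝ} (hγ : 0 < γ) {q : E → ℝ} (hq : q ∈ tailClass d γ C)
    {b : ℝ} (hb : 0 < b) :
    ∃ U : ℝ, 0 ≤ U ∧ ∀ s R : ℝ, 0 < s → s ≤ b → 0 < R → ∀ x : E, R ≤ ‖x‖ →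
      smoothed q (s ^ 2) x ≤ U * R ^ (-(1 + γ + d)) := by
  obtain ⟨⟨hqi, hq0, hq1⟩, hqC⟩ := hq
  set T : ℝ := 1 + γ + d with hT
  have hTpos : 0 < T := by positivity
  have hC : 0 ≤ C := by
    have h1 := (hq0 0).trans (hqC 0)
    simpa using h1
  set G : ℝ := 1 / (2 * π) ^ ((d : ℝ) / 2) with hG
  refine ⟨C * 2 ^ T + G * exp (2 * T ^ 2) * b ^ (1 + γ), by positivity, ?_⟩
  intro s R hs hsb hR x hx
  have ht : 0 < s ^ 2 := by positivity
  have hg : Integrable fun y => gaussKernel (s ^ 2) (x - y) :=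
    (integrable_gaussKernel ht).comp_sub_left x
  set B : ℝ := G * (s ^ d)⁻¹ * exp (-(R / s / 2) ^ 2 / 2) with hB
  -- Either `‖y‖ ≥ R / 2` and the tail bound on `q` applies, or the Gaussian must cover a distance
  -- of at least `R / 2`. Bounding by the sum of the two cases avoids splitting the integral.
  have hpt : ∀ y, gaussKernel (s ^ 2) (x - y) * q y
      ≤ gaussKernel (s ^ 2) (x - y) * (C * (R / 2) ^ (-T)) + B * q y := by
    intro y
    have hgp := (gaussKernel_pos ht (x - y)).le
    have hBp : 0 ≤ B := by positivity
    rcases le_total (R / 2) ‖y‖ with hy | hy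
    · have h1 : q y ≤ C * (R / 2) ^ (-T) := by
        refine (hqC y).trans ?_
        rw [rpow_neg (by positivity), ← div_eq_mul_inv]
        have h2 : (R / 2) ^ T ≤ (1 + ‖y‖ ^ 2) ^ (T / 2) := by
          calc (R / 2) ^ T = ((R / 2) ^ 2) ^ (T / 2) := by
                rw [← rpow_natCast (R / 2) 2, ← rpow_mul (by positivity)]
                congr 1; push_cast; ring
            _ ≤ _ := by
                gcongr
                nlinarith [sq_nonneg ‖y‖]
        gcongr
      have h2 : 0 ≤ B * q y := mul_nonneg hBp (hq0 y)
      have h3 := mul_le_mul_of_nonneg_left h1 hgp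
      linarith
    · have h1 : gaussKernel (s ^ 2) (x - y) ≤ B := by
        rw [gaussKernel_sq hs, hB]
        have h2 : R / 2 ≤ ‖x - y‖ := by linarith [norm_sub_norm_le x y]
        have h3 : R / s / 2 ≤ ‖x - y‖ / s := by
          rw [div_right_comm]; gcongr
        gcongr
      have h2 : 0 ≤ gaussKernel (s ^ 2) (x - y) * (C * (R / 2) ^ (-T)) := by positivity
      have h3 := mul_le_mul_of_nonneg_right h1 (hq0 y)
      linarith
  have h1 : smoothed q (s ^ 2) x ≤ C * (R / 2) ^ (-T) + B := by
    calc smoothed q (s ^ 2) x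
        ≤ ∫ y, (gaussKernel (s ^ 2) (x - y) * (C * (R / 2) ^ (-T)) + B * q y) :=
          integral_mono (integrable_gaussKernel_mul hqi ht x)
            ((hg.mul_const _).add (hqi.const_mul B)) hpt
      _ = _ := by
        rw [integral_add (hg.mul_const _) (hqi.const_mul B), integral_mul_const,
          integral_const_mul, hq1, integral_sub_left_eq_self (fun y => gaussKernel (s ^ 2) y) volume x,
          integral_gaussKernel ht, one_mul, mul_one]
  refine h1.trans ?_
  have h2 : (R / 2) ^ (-T) = 2 ^ T * R ^ (-T) := by
    rw [div_rpow hR.le (by norm_num), rpow_neg (by norm_num : (0:ℝ) ≤ 2)]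
    field_simp
  have h3 : B ≤ G * exp (2 * T ^ 2) * b ^ (1 + γ) * R ^ (-T) := by
    have h4 := exp_neg_sq_le_rpow (y := R / s) (by positivity) hTpos.le
    have h5 : (s ^ d)⁻¹ * (R / s) ^ (-T) = s ^ (1 + γ) * R ^ (-T) := by
      rw [div_rpow hR.le hs.le, rpow_neg hs.le, div_inv_eq_mul, ← rpow_natCast s d,
        show T = (1 + γ) + d by rw [hT], rpow_add hs]
      have := (rpow_pos_of_pos hs (d : ℝ)).ne'
      field_simp
    calc B ≤ G * (s ^ d)⁻¹ * (exp (2 * T ^ 2) * (R / s) ^ (-T)) := by rw [hB]; gcongr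
      _ = G * exp (2 * T ^ 2) * ((s ^ d)⁻¹ * (R / s) ^ (-T)) := by ring
      _ = G * exp (2 * T ^ 2) * s ^ (1 + γ) * R ^ (-T) := by rw [h5]; ring
      _ ≤ _ := by gcongr
  rw [h2]
  linarith

end Tails

/-! ### Stability of the Sobolev constraint -/

section SobolevPerturbation

variable {d : ℕ}

local notation "E" => EuclideanSpace ℝ (Fin d)

theorem integrable_fourierTr_integrand {p : E → ℝ} (hp : Integrable p) (ω : E) :
    Integrable fun x => (p x : ℂ) * Complex.exp (-Complex.I * ((inner ℝ ω x : ℝ) : ℂ)) := by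
  refine (hp.ofReal (𝕜 := ℂ)).mul_bdd (c := 1) (Continuous.aestronglyMeasurable (by fun_prop))
    (.of_forall fun y => ?_)
  rw [Complex.norm_exp]; simp

theorem continuous_fourierTr {p : E → ℝ} (hp : Integrable p) : Continuous (fourierTr p) := by
  refine continuous_of_dominated (bound := fun x => ‖p x‖)
    (fun ω => (integrable_fourierTr_integrand hp ω).aestronglyMeasurable)
    (fun ω => .of_forall fun x => ?_) hp.norm (.of_forall fun x => by fun_prop)
  rw [norm_mul, Complex.norm_exp]; simp

theorem fourierTr_const_mul_add (η : ℝ) {q V : E → ℝ} (hq : Integrable q) (hV : Integrable V)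
    (ω : E) :
    fourierTr (fun x => η * q x + V x) ω = η * fourierTr q ω + fourierTr V ω := by
  unfold fourierTr
  rw [← integral_const_mul, ← integral_add ((integrable_fourierTr_integrand hq ω).const_mul _)
    (integrable_fourierTr_integrand hV ω)]
  congr 1; ext x; push_cast; ring

/-- A density with room to spare in the Sobolev constraint can absorb small perturbations. -/
theorem exists_sobolev_perturbation {L' L : ℝ} (hL' : 0 < L') (hL : L' < L) :
    ∃ ε : ℝ, 0 < ε ∧ ∀ (q V : E → ℝ) (η : ℝ) (w : E → ℝ), Integrable q → Integrable V →
      0 ≤ η → η ≤ 1 → Continuous w →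
      ∫⁻ ω, ENNReal.ofReal (|w ω| ^ 2 * ‖fourierTr q ω‖ ^ 2) ≤ ENNReal.ofReal ((2 * π) ^ d * L' ^ 2) →
      ∫⁻ ω, ENNReal.ofReal (|w ω| ^ 2 * ‖fourierTr V ω‖ ^ 2) ≤ ENNReal.ofReal ε →
      ∫⁻ ω, ENNReal.ofReal (|w ω| ^ 2 * ‖fourierTr (fun x => η * q x + V x) ω‖ ^ 2)
        ≤ ENNReal.ofReal ((2 * π) ^ d * L ^ 2) := by
  -- In `(A + B) ^ 2 ≤ (1 + e) A ^ 2 + (1 + 1 / e) B ^ 2`, this `e` makes `(1 + e) L' ^ 2` the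
  -- midpoint of `L' ^ 2` and `L ^ 2`; `ε` spends the other half of the gap.
  set e : ℝ := (L ^ 2 - L' ^ 2) / (2 * L' ^ 2) with he
  have hdiff : 0 < L ^ 2 - L' ^ 2 := by nlinarith
  have hepos : 0 < e := by positivity
  set ε : ℝ := (2 * π) ^ d * ((L ^ 2 - L' ^ 2) / 2) / (1 + 1 / e) with hε
  refine ⟨ε, by positivity, ?_⟩
  intro q V η w hq hV hη0 hη1 hw hqL hVε
  have hpt : ∀ ω, ENNReal.ofReal (|w ω| ^ 2 * ‖fourierTr (fun x => η * q x + V x) ω‖ ^ 2)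
      ≤ ENNReal.ofReal (1 + e) * ENNReal.ofReal (|w ω| ^ 2 * ‖fourierTr q ω‖ ^ 2)
        + ENNReal.ofReal (1 + 1 / e) * ENNReal.ofReal (|w ω| ^ 2 * ‖fourierTr V ω‖ ^ 2) := by
    intro ω
    rw [← ENNReal.ofReal_mul (by positivity), ← ENNReal.ofReal_mul (by positivity),
      ← ENNReal.ofReal_add (by positivity) (by positivity), fourierTr_const_mul_add η hq hV]
    refine ENNReal.ofReal_le_ofReal ?_
    set A := ‖fourierTr q ω‖
    set B := ‖fourierTr V ω‖
    have h1 : ‖(η : ℂ) * fourierTr q ω + fourierTr V ω‖ ≤ A + B := by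
      refine (norm_add_le _ _).trans ?_
      rw [norm_mul, Complex.norm_real, Real.norm_of_nonneg hη0]
      have : η * A ≤ 1 * A := by gcongr
      linarith
    have h2 : (A + B) ^ 2 ≤ (1 + e) * A ^ 2 + (1 + 1 / e) * B ^ 2 := by
      have h3 : (1 + e) * A ^ 2 + (1 + 1 / e) * B ^ 2 - (A + B) ^ 2 = 1 / e * (e * A - B) ^ 2 := by
        field_simp; ring
      have h4 : 0 ≤ 1 / e * (e * A - B) ^ 2 := by positivity
      linarith
    calc |w ω| ^ 2 * ‖(η : ℂ) * fourierTr q ω + fourierTr V ω‖ ^ 2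
        ≤ |w ω| ^ 2 * ((1 + e) * A ^ 2 + (1 + 1 / e) * B ^ 2) := by
          gcongr
          exact (by gcongr : _ ≤ (A + B) ^ 2).trans h2
      _ = _ := by ring
  have hmeas : Measurable fun ω => ENNReal.ofReal (1 + e) *
      ENNReal.ofReal (|w ω| ^ 2 * ‖fourierTr q ω‖ ^ 2) := by
    have := continuous_fourierTr hq
    exact (Continuous.measurable (by fun_prop)).ennreal_ofReal.const_mul _
  refine (lintegral_mono hpt).trans ?_
  rw [lintegral_add_left hmeas, lintegral_const_mul' _ _ ENNReal.ofReal_ne_top,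
    lintegral_const_mul' _ _ ENNReal.ofReal_ne_top]
  refine (add_le_add (mul_le_mul_right hqL _) (mul_le_mul_right hVε _)).trans (le_of_eq ?_)
  rw [← ENNReal.ofReal_mul (by positivity), ← ENNReal.ofReal_mul (by positivity),
      ← ENNReal.ofReal_add (by positivity) (by positivity)]
  congr 1
  rw [hε, mul_div_cancel₀ _ (by positivity), he]
  field_simp
  ring

end SobolevPerturbation

/-! ### The grid of bump centres -/

section Grid

variable {d : ℕ}

local notation "E" => EuclideanSpace ℝ (Fin d)

/-- The points of a cubic grid of mesh `8 s` in the cube `[8 s N, 16 s N) ^ d`. -/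
noncomputable def gridPoint (s : ℝ) {N : ℕ} (k : Fin d → Fin N) : E :=
  WithLp.toLp 2 fun i => 8 * s * (N + (k i : ℕ))

theorem le_norm_gridPoint (hd : 1 ≤ d) {s : ℝ} (hs : 0 < s) {N : ℕ} (k : Fin d → Fin N) :
    8 * (s * N) ≤ ‖gridPoint s k‖ := by
  have h1 := PiLp.norm_apply_le (gridPoint s k) ⟨0, hd⟩
  refine le_trans ?_ h1
  simp only [gridPoint]
  rw [Real.norm_of_nonneg (by positivity)]
  have : (0 : ℝ) ≤ (k ⟨0, hd⟩ : ℕ) := by positivity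
  nlinarith

theorem norm_gridPoint_le {s : ℝ} (hs : 0 < s) {N : ℕ} (k : Fin d → Fin N) :
    ‖gridPoint s k‖ ≤ 16 * (s * N) * d := by
  rw [← abs_of_nonneg (norm_nonneg _), ← abs_of_nonneg (by positivity : 0 ≤ 16 * (s * N) * (d : ℝ)),
    ← sq_le_sq, EuclideanSpace.norm_sq_eq]
  calc ∑ i, ‖gridPoint s k i‖ ^ 2 ≤ ∑ i : Fin d, (16 * (s * N)) ^ 2 := by
        refine Finset.sum_le_sum fun i _ => ?_
        simp only [gridPoint]
        rw [Real.norm_of_nonneg (by positivity)]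
        have : ((k i : ℕ) : ℝ) ≤ N := by exact_mod_cast (k i).2.le
        refine pow_le_pow_left₀ (by positivity) ?_ 2
        nlinarith
    _ = (16 * (s * N)) ^ 2 * d := by simp [mul_comm]
    _ ≤ (16 * (s * N)) ^ 2 * (d : ℝ) ^ 2 := by
        gcongr
        exact_mod_cast Nat.le_self_pow (by norm_num) d
    _ = _ := by ring

/-- The mesh `8 s` serves two purposes: balls of radius `3 s` about grid points are disjoint, and
centres displaced by `2 s` remain `4 s` apart. -/
theorem le_dist_gridPoint {s : ℝ} (hs : 0 < s) {N : ℕ} {k l : Fin d → Fin N} (hkl : k ≠ l) :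
    8 * s ≤ dist (gridPoint s k) (gridPoint s l) := by
  obtain ⟨i, hi⟩ := Function.ne_iff.1 hkl
  rw [dist_eq_norm]
  refine le_trans ?_ (PiLp.norm_apply_le (gridPoint s k - gridPoint s l) i)
  have h1 : (gridPoint s k - gridPoint s l) i = 8 * s * (((k i : ℕ) : ℤ) - ((l i : ℕ) : ℤ) : ℤ) := by
    simp only [gridPoint, PiLp.sub_apply]
    push_cast; ring
  have h2 : (1 : ℝ) ≤ |((((k i : ℕ) : ℤ) - ((l i : ℕ) : ℤ) : ℤ) : ℝ)| := by
    rw [← Int.cast_abs]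
    have : ((k i : ℕ) : ℤ) - ((l i : ℕ) : ℤ) ≠ 0 := by
      rw [sub_ne_zero]
      exact_mod_cast fun h => hi (Fin.ext h)
    exact_mod_cast Int.one_le_abs this
  rw [h1, Real.norm_eq_abs, abs_mul, abs_of_pos (by positivity : 0 < 8 * s)]
  nlinarith

theorem bumpSum_le {J : Type*} [Fintype J] {ψ : E → ℝ}
    (hψ : tsupport ψ ⊆ Metric.closedBall 0 1) (h1 : ∀ x, ψ x ≤ 1) {a s : ℝ} (ha : 0 ≤ a)
    (hs : 0 < s) {c : J → E} (hc : ∀ i j, i ≠ j → 2 * s < dist (c i) (c j)) (x : E) :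
    bumpSum ψ a s c x ≤ a := by
  unfold bumpSum
  by_cases h : ∃ j, dist x (c j) ≤ s
  · obtain ⟨j, hj⟩ := h
    rw [Finset.sum_eq_single j]
    · exact mul_le_of_le_one_right ha (h1 _)
    · intro i _ hij
      have h2 := hc i j hij
      have h3 := dist_triangle_left (c i) (c j) x
      rw [eq_zero_of_tsupport_subset hψ hs (by linarith), mul_zero]
    · simp
  · push Not at h
    rw [Finset.sum_eq_zero fun j _ => by rw [eq_zero_of_tsupport_subset hψ hs (h j), mul_zero]]
    exact ha

theorem bumpSum_eq_zero {J : Type*} [Fintype J] {ψ : E → ℝ}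
    (hψ : tsupport ψ ⊆ Metric.closedBall 0 1) {a s : ℝ} (hs : 0 < s) {c : J → E} {x : E}
    (h : ∀ j, s < dist x (c j)) : bumpSum ψ a s c x = 0 :=
  Finset.sum_eq_zero fun j _ => by rw [eq_zero_of_tsupport_subset hψ hs (h j), mul_zero]

/-- The direction in which a bump is displaced. -/
def shiftSign (b : Bool) : ℝ := if b then 2 else -2

/-- Grid points, displaced by `± 2 v` according to the entries of a Boolean vector. -/
noncomputable def shiftedGrid (s : ℝ) (v : E) {N : ℕ} (θ : (Fin d → Fin N) → Bool)
    (k : Fin d → Fin N) : E :=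
  gridPoint s k + shiftSign (θ k) • v

theorem dist_shiftedGrid_gridPoint {s : ℝ} {v : E} (hv : ‖v‖ = s) {N : ℕ}
    (θ : (Fin d → Fin N) → Bool) (k : Fin d → Fin N) :
    dist (shiftedGrid s v θ k) (gridPoint s k) = 2 * s := by
  rw [shiftedGrid, dist_self_add_left, norm_smul, hv]
  unfold shiftSign
  split_ifs <;> norm_num

theorem two_mul_lt_dist_shiftedGrid {s : ℝ} (hs : 0 < s) {v : E} (hv : ‖v‖ = s) {N : ℕ}
    (θ : (Fin d → Fin N) → Bool) (k l : Fin d → Fin N) (hkl : k ≠ l) :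
    2 * s < dist (shiftedGrid s v θ k) (shiftedGrid s v θ l) := by
  have h1 := le_dist_gridPoint hs hkl
  have h2 := dist_triangle4 (gridPoint s k) (shiftedGrid s v θ k) (shiftedGrid s v θ l)
    (gridPoint s l)
  rw [dist_comm (gridPoint s k) (shiftedGrid s v θ k), dist_shiftedGrid_gridPoint hv, dist_shiftedGrid_gridPoint hv] at h2
  linarith

end Grid

/-! ### Membership of the perturbed densities in the model class -/

section Model

variable {d : ℕ}

local notation "E" => EuclideanSpace ℝ (Fin d)

/-- A bound for the Sobolev energies of sums of disjoint bumps that is uniform over the monomials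
of a given degree. -/
theorem exists_sobolev_bumpSum_le {φ : E → ℝ} (hφ : ContDiff ℝ (⊤ : ℕ∞) φ)
    (hsupp : tsupport φ ⊆ Metric.closedBall 0 1) (β : ℝ) :
    ∃ M : ℝ, 0 < M ∧ ∀ (J : Type) [Fintype J] (a s : ℝ) (c : J → E), 0 < s →
      (∀ i j, i ≠ j → 2 * s < dist (c i) (c j)) → ∀ α : Fin d → ℕ, ∑ i, (α i : ℝ) = β →
      ∫⁻ ω : E, ENNReal.ofReal (|∏ i, ω i ^ α i| ^ 2 * ‖fourierTr (bumpSum φ a s c) ω‖ ^ 2)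
        ≤ ENNReal.ofReal (M * (Fintype.card J * (a ^ 2 * s ^ d * s ^ (-(2 * β))))) := by
  have hc : HasCompactSupport φ := (isCompact_closedBall (0 : E) 1).of_isClosed_subset
    (isClosed_tsupport φ) hsupp
  choose Ψ hΨ1 hΨ2 hΨ3 using exists_norm_fourierTr_eq_monomial hφ hc
  -- Every multi-index of degree `β` has entries at most `⌊β⌋`, so this finite box contains all of
  -- them and a sum over it bounds each energy.
  set F : Finset (Fin d → ℕ) := Fintype.piFinset fun _ => Finset.range (⌊β⌋₊ + 1)
  have hF0 : ∀ α, 0 ≤ ∫ x, Ψ α x ^ 2 := fun α => integral_nonneg fun x => sq_nonneg _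
  have hFs : 0 ≤ ∑ α ∈ F, ∫ x, Ψ α x ^ 2 := Finset.sum_nonneg fun α _ => hF0 α
  refine ⟨(2 * π) ^ d * (1 + ∑ α ∈ F, ∫ x, Ψ α x ^ 2), by positivity, ?_⟩
  intro J _ a s c hs hcs α hα
  rw [lintegral_monomial_fourierTr_bumpSum (hφ.continuous.integrable_of_hasCompactSupport hc)
    (hΨ1 α) ((hΨ2 α).trans hsupp) (hΨ3 α) a hs hcs]
  have hαF : α ∈ F := by
    rw [Fintype.mem_piFinset]
    intro i
    rw [Finset.mem_range, Nat.lt_succ_iff]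
    refine Nat.le_floor ?_
    rw [← hα]
    exact Finset.single_le_sum (f := fun i => (α i : ℝ)) (fun i _ => by positivity)
      (Finset.mem_univ i)
  have h1 : ((s ^ ∑ i, α i)⁻¹) ^ 2 = s ^ (-(2 * β)) := by
    rw [rpow_neg hs.le, ← hα, mul_comm, rpow_mul hs.le]
    have : ∑ i, (α i : ℝ) = ((∑ i, α i : ℕ) : ℝ) := by push_cast; rfl
    rw [this, rpow_natCast, inv_pow]
    norm_cast
  rw [h1]
  refine ENNReal.ofReal_le_ofReal ?_
  have h2 : ∫ x, Ψ α x ^ 2 ≤ 1 + ∑ α ∈ F, ∫ x, Ψ α x ^ 2 := by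
    have := Finset.single_le_sum (f := fun α => ∫ x, Ψ α x ^ 2) (fun α _ => hF0 α) hαF
    linarith
  gcongr

/-- Adding well-separated bumps far out to a density in the interior of the model class gives a
density in the model class. -/
theorem exists_bumpSum_mem_modelClass {γ β C C' L L' : ℝ} (hγ : 0 < γ)
    (hC : C' < C) (hL' : 0 < L') (hL : L' < L) {q : E → ℝ} (hq : q ∈ modelClass d γ C' β L')
    {φ : E → ℝ} (hφ : ContDiff ℝ (⊤ : ℕ∞) φ) (hsupp : tsupport φ ⊆ Metric.closedBall 0 1)
    (hφ0 : ∀ x, 0 ≤ φ x) (hφ1 : ∀ x, φ x ≤ 1) {A D : ℝ} (hA : 1 ≤ A) (hD : 0 ≤ D) :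
    ∃ κ : ℝ, 0 < κ ∧ ∀ (J : Type) [Fintype J] (s R κ' : ℝ) (c : J → E), 0 < s → 1 ≤ R → 0 ≤ κ' →
      κ' ≤ κ → (∀ i j, i ≠ j → 2 * s < dist (c i) (c j)) → (∀ j, ‖c j‖ + s ≤ A * R) →
      Fintype.card J * s ^ d ≤ (2 * R) ^ d → R ^ ((d : ℝ) - 2 * (1 + γ + d)) ≤ D * s ^ (2 * β) →
      Fintype.card J * (κ' * R ^ (-(1 + γ + d)) * s ^ d * ∫ y, φ y) ≤ 1 ∧
      (fun x => (1 - Fintype.card J * (κ' * R ^ (-(1 + γ + d)) * s ^ d * ∫ y, φ y)) * q x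
        + bumpSum φ (κ' * R ^ (-(1 + γ + d))) s c x) ∈ modelClass d γ C β L := by
  obtain ⟨⟨⟨hqi, hq0, hq1⟩, hqC⟩, -, hqL⟩ := hq
  have hcs : HasCompactSupport φ := (isCompact_closedBall (0 : E) 1).of_isClosed_subset
    (isClosed_tsupport φ) hsupp
  have hφi : Integrable φ := hφ.continuous.integrable_of_hasCompactSupport hcs
  obtain ⟨M, hM, hsob⟩ := exists_sobolev_bumpSum_le hφ hsupp β
  obtain ⟨ε, hε, hpert⟩ := exists_sobolev_perturbation (d := d) hL' hL
  set T : ℝ := 1 + γ + d with hT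
  have hTpos : 0 < T := by positivity
  set I : ℝ := ∫ y, φ y with hI
  have hI0 : 0 ≤ I := integral_nonneg hφ0
  have hC'0 : 0 ≤ C' := by simpa using (hq0 0).trans (hqC 0)
  -- In order: `κ' ^ 2 ≤ κ'`; the tail constraint at radius at most `A R`, paid from `C - C'`; total
  -- bump mass at most 1; Sobolev energy at most `ε`.
  refine ⟨min (min 1 ((C - C') / (2 * A) ^ T))
    (min (1 / (2 ^ d * (I + 1))) (ε / (M * 2 ^ d * (D + 1)))), ?_, ?_⟩
  · have : 0 < C - C' := by linarith
    positivity
  intro J _ s R κ' c hs hR hκ0 hκ hc hcA hcard hRD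
  obtain ⟨⟨hκ1, hκC⟩, hκI, hκε⟩ : (κ' ≤ 1 ∧ κ' ≤ (C - C') / (2 * A) ^ T) ∧
      κ' ≤ 1 / (2 ^ d * (I + 1)) ∧ κ' ≤ ε / (M * 2 ^ d * (D + 1)) := by
    simpa only [le_min_iff] using hκ
  have hR0 : 0 < R := by linarith
  set ρ : ℝ := R ^ (-T) with hρ
  have hρpos : 0 < ρ := rpow_pos_of_pos hR0 _
  set η : ℝ := Fintype.card J * (κ' * ρ * s ^ d * I) with hη
  have hη0 : 0 ≤ η := by positivity
  have hη1 : η ≤ 1 := by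
    have h1 : (2 * R) ^ d * ρ ≤ 2 ^ d := by
      rw [mul_pow, mul_assoc, ← rpow_natCast R d, hρ, ← rpow_add hR0]
      refine mul_le_of_le_one_right (by positivity) (rpow_le_one_of_one_le_of_nonpos hR ?_)
      rw [hT]; linarith
    have h2 : κ' * (2 ^ d * (I + 1)) ≤ 1 := (le_div_iff₀ (by positivity)).1 hκI
    calc η = κ' * I * (Fintype.card J * s ^ d * ρ) := by rw [hη]; ring
      _ ≤ κ' * I * ((2 * R) ^ d * ρ) := by gcongr
      _ ≤ κ' * (I + 1) * 2 ^ d := by gcongr; linarith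
      _ ≤ 1 := by linarith
  set V := bumpSum φ (κ' * ρ) s c with hV
  have hVi : Integrable V := integrable_bumpSum hφi _ hs c
  have hV0 : ∀ x, 0 ≤ V x := fun x => Finset.sum_nonneg fun j _ => by
    have := hφ0 (s⁻¹ • (x - c j)); positivity
  have hdens : IsDensity fun x => (1 - η) * q x + V x := by
    refine ⟨(hqi.const_mul _).add hVi, fun x =>
      add_nonneg (mul_nonneg (by linarith) (hq0 x)) (hV0 x), ?_⟩
    rw [integral_add (hqi.const_mul _) hVi, integral_const_mul, hq1, hV, integral_bumpSum hφi _ hs]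
    rw [hη]; ring
  refine ⟨hη1, ⟨hdens, fun x => ?_⟩, hdens, fun α hα => ?_⟩
  · have hE : 0 < (1 + ‖x‖ ^ 2) ^ (T / 2) := by positivity
    have h1 : (1 - η) * q x ≤ C' / (1 + ‖x‖ ^ 2) ^ (T / 2) := by
      refine le_trans ?_ (hqC x)
      exact mul_le_of_le_one_left (hq0 x) (by linarith)
    have h2 : V x ≤ (C - C') / (1 + ‖x‖ ^ 2) ^ (T / 2) := by
      by_cases hx : ∃ j, dist x (c j) ≤ s
      · obtain ⟨j, hj⟩ := hx
        refine (bumpSum_le hsupp hφ1 (by positivity) hs hc x).trans ?_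
        have h3 : ‖x‖ ≤ A * R := by
          have := norm_le_norm_add_norm_sub' x (c j)
          rw [← dist_eq_norm] at this
          linarith [hcA j]
        have h4 : (1 + ‖x‖ ^ 2) ^ (T / 2) ≤ (2 * A) ^ T * R ^ T := by
          rw [← mul_rpow (by positivity) (by positivity)]
          calc (1 + ‖x‖ ^ 2) ^ (T / 2) ≤ ((2 * A * R) ^ 2) ^ (T / 2) := by
                gcongr
                have h5 : ‖x‖ ^ 2 ≤ (A * R) ^ 2 := by gcongr
                have h6 : 1 ≤ A * R := one_le_mul_of_one_le_of_one_le hA hR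
                nlinarith
            _ = _ := by
                rw [← rpow_natCast (2 * A * R) 2, ← rpow_mul (by positivity)]
                congr 1; push_cast; ring
        rw [le_div_iff₀ hE]
        calc κ' * ρ * (1 + ‖x‖ ^ 2) ^ (T / 2) ≤ κ' * ρ * ((2 * A) ^ T * R ^ T) := by gcongr
          _ = κ' * (2 * A) ^ T := by
            rw [hρ, rpow_neg hR0.le]
            have := (rpow_pos_of_pos hR0 T).ne'
            field_simp
          _ ≤ _ := (le_div_iff₀ (by positivity)).1 hκC
      · push Not at hx
        rw [hV, bumpSum_eq_zero hsupp hs hx]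
        exact div_nonneg (by linarith) hE.le
    calc (1 - η) * q x + V x ≤ C' / (1 + ‖x‖ ^ 2) ^ (T / 2) + (C - C') / (1 + ‖x‖ ^ 2) ^ (T / 2) :=
          add_le_add h1 h2
      _ = _ := by rw [← add_div]; congr 1; ring
  · refine hpert q V (1 - η) (fun ω => ∏ i, ω i ^ α i) hqi hVi (by linarith) (by linarith)
      (by fun_prop) (hqL α hα) ((hsob J _ s c hs hc α hα).trans (ENNReal.ofReal_le_ofReal ?_))
    have h1 : (2 * R) ^ d * ρ ^ 2 = 2 ^ d * R ^ ((d : ℝ) - 2 * T) := by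
      rw [mul_pow, mul_assoc, ← rpow_natCast R d, hρ, ← rpow_natCast (R ^ (-T)) 2,
        ← rpow_mul hR0.le, ← rpow_add hR0]
      congr 2; push_cast; ring
    have h2 : κ' * (M * 2 ^ d * (D + 1)) ≤ ε := (le_div_iff₀ (by positivity)).1 hκε
    have h3 : κ' ^ 2 ≤ κ' := by nlinarith
    have h4 : s ^ (2 * β) * s ^ (-(2 * β)) = 1 := by rw [← rpow_add hs]; simp
    calc M * (Fintype.card J * ((κ' * ρ) ^ 2 * s ^ d * s ^ (-(2 * β))))
        = M * κ' ^ 2 * s ^ (-(2 * β)) * ρ ^ 2 * (Fintype.card J * s ^ d) := by ring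
      _ ≤ M * κ' ^ 2 * s ^ (-(2 * β)) * ρ ^ 2 * (2 * R) ^ d := by gcongr
      _ = M * κ' ^ 2 * s ^ (-(2 * β)) * 2 ^ d * R ^ ((d : ℝ) - 2 * T) := by
          linear_combination M * κ' ^ 2 * s ^ (-(2 * β)) * h1
      _ ≤ M * κ' * s ^ (-(2 * β)) * 2 ^ d * (D * s ^ (2 * β)) := by gcongr
      _ = M * κ' * 2 ^ d * D := by linear_combination M * κ' * 2 ^ d * D * h4
      _ ≤ κ' * (M * 2 ^ d * (D + 1)) := by
          have : 0 ≤ κ' * M * 2 ^ d := by positivity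
          nlinarith
      _ ≤ ε := h2

end Model

/-! ### The lower bound at a given scale, and non-degeneracy -/

section LowerBound

variable {d : ℕ}

local notation "E" => EuclideanSpace ℝ (Fin d)

theorem exists_smooth_bump (d : ℕ) : ∃ φ : EuclideanSpace ℝ (Fin d) → ℝ,
    ContDiff ℝ (⊤ : ℕ∞) φ ∧ tsupport φ ⊆ Metric.closedBall 0 1 ∧ (∀ x, 0 ≤ φ x) ∧
      (∀ x, φ x ≤ 1) ∧ Integrable φ ∧ 0 < ∫ x, φ x := by
  let f : ContDiffBump (0 : EuclideanSpace ℝ (Fin d)) :=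
    ⟨1 / 2, 1, by norm_num, by norm_num⟩
  exact ⟨f, f.contDiff, f.tsupport_eq.subset, fun x => f.nonneg, fun x => f.le_one, f.integrable,
    f.integral_pos⟩

theorem shiftedGrid_flipAt_self {s : ℝ} {v : E} {N : ℕ} (θ : (Fin d → Fin N) → Bool)
    (k : Fin d → Fin N) :
    (shiftedGrid s v θ k = gridPoint s k + (2 : ℝ) • v ∧
      shiftedGrid s v (flipAt k θ) k = gridPoint s k + (-2 : ℝ) • v) ∨
    (shiftedGrid s v θ k = gridPoint s k + (-2 : ℝ) • v ∧
      shiftedGrid s v (flipAt k θ) k = gridPoint s k + (2 : ℝ) • v) := by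
  cases h : θ k <;> simp [shiftedGrid, shiftSign, flipAt, h]

theorem shiftedGrid_flipAt_of_ne {s : ℝ} {v : E} {N : ℕ} (θ : (Fin d → Fin N) → Bool)
    {k j : Fin d → Fin N} (h : j ≠ k) :
    shiftedGrid s v (flipAt k θ) j = shiftedGrid s v θ j := by
  simp [shiftedGrid, flipAt, h]

/-- The minimax lower bound in terms of the noise level `s = √t` and the radius `R` beyond which
the density falls below the level `1 / (n s ^ d)`. -/
theorem exists_minimaxRisk_ge_of_scale (hd : 1 ≤ d) {γ β C L : ℝ} (hγ : 0 < γ)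
    (hC : NondegenerateRadii d γ C β L) {B D : ℝ} (hB : 0 < B) (hD : 0 ≤ D) :
    ∃ c : ℝ, 0 < c ∧ ∀ (n : ℕ) (s R : ℝ), 0 < n → 0 < s → s ≤ B → 1 ≤ R → s ≤ R →
      R ^ (1 + γ + d) = n * s ^ d → R ^ ((d : ℝ) - 2 * (1 + γ + d)) ≤ D * s ^ (2 * β) →
      ENNReal.ofReal (c * (R ^ ((d : ℝ) - (1 + γ + d)) / s ^ 2))
        ≤ minimaxRisk (modelClass d γ C β L) n (s ^ 2) := by
  obtain ⟨C', L', hC', hL', hL, q, hq⟩ := hC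
  obtain ⟨φ, hφ, hsupp, hφ0, hφ1, hφi, hI⟩ := exists_smooth_bump d
  have hdR : (1 : ℝ) ≤ d := by exact_mod_cast hd
  -- Grid points have norm at most `16 (s N) d ≤ 32 d R`; displacement and bump width add `3 s ≤ 3 d
  -- R`, hence `35 d`.
  obtain ⟨κ₀, hκ₀, hmem⟩ := exists_bumpSum_mem_modelClass hγ hC' hL' hL hq hφ hsupp hφ0 hφ1
    (A := 35 * d) (by linarith) hD
  obtain ⟨U₀, hU₀, htail⟩ := exists_smoothed_tail_le hγ hq.1 hB
  set I : ℝ := ∫ x, φ x with hIdef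
  -- Each bump has mass `κ I / n`, so the second bound makes it at most `1 / (2 n)`.
  set κ : ℝ := min κ₀ (1 / (2 * I)) with hκ
  have hκpos : 0 < κ := by positivity
  -- In units of `a = κ R ^ (-T)`, the smoothed `q` contributes at most `U₀ / κ` and all the other
  -- bumps together at most 1.
  obtain ⟨c₁, hc₁, hsep⟩ := exists_separation_bump hφi hφ0 hI hsupp (U := U₀ / κ + 1)
    (by positivity)
  obtain ⟨⟨⟨hqi, hq0, hq1⟩, -⟩, -⟩ := hq
  refine ⟨κ * c₁ / 4, by positivity, ?_⟩
  intro n s R hn hs hsB hR hsR hRn hRD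
  set T : ℝ := 1 + γ + d with hT
  have hR0 : 0 < R := by linarith
  have hn0 : (0 : ℝ) < n := by exact_mod_cast hn
  set ρ : ℝ := R ^ (-T) with hρ
  have hρn : ρ * (n * s ^ d) = 1 := by rw [← hRn, hρ, ← rpow_add hR0]; simp
  have hρpos : 0 < ρ := rpow_pos_of_pos hR0 _
  set a : ℝ := κ * ρ with ha
  have hapos : 0 < a := by positivity
  set N : ℕ := ⌈R / s⌉₊ with hN
  have hN1 : R ≤ s * N := by
    have := Nat.le_ceil (R / s)
    rwa [div_le_iff₀ hs, mul_comm] at this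
  have hN2 : s * N ≤ 2 * R := by
    have h1 := (Nat.ceil_lt_add_one (div_pos hR0 hs).le).le
    calc s * N ≤ s * (R / s + 1) := by gcongr
      _ = R + s := by field_simp
      _ ≤ 2 * R := by linarith
  set v : E := s • EuclideanSpace.single ⟨0, hd⟩ 1 with hv'
  have hv : ‖v‖ = s := by simp [hv', norm_smul, abs_of_pos hs]
  have hcard : (Fintype.card (Fin d → Fin N) : ℝ) = (N : ℝ) ^ d := by simp
  set η : ℝ := Fintype.card (Fin d → Fin N) * (a * s ^ d * I) with hη
  set p : ((Fin d → Fin N) → Bool) → E → ℝ := fun θ x =>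
    (1 - η) * q x + bumpSum φ a s (shiftedGrid s v θ) x with hp
  have hdist := fun θ : (Fin d → Fin N) → Bool => two_mul_lt_dist_shiftedGrid hs hv θ
  have hpm' : ∀ θ, η ≤ 1 ∧ p θ ∈ modelClass d γ C β L := by
    intro θ
    refine hmem (Fin d → Fin N) s R κ (shiftedGrid s v θ) hs hR hκpos.le (min_le_left _ _) (hdist θ)
      (fun k => ?_) ?_ hRD
    · have h1 := norm_le_norm_add_norm_sub' (shiftedGrid s v θ k) (gridPoint s k)
      rw [← dist_eq_norm, dist_shiftedGrid_gridPoint hv] at h1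
      have h2 := norm_gridPoint_le hs k
      have h3 : 16 * (s * N) * d ≤ 16 * (2 * R) * d := by gcongr
      have h4 : R * 1 ≤ R * d := by gcongr
      linarith
    · rw [hcard, ← mul_pow]
      exact pow_le_pow_left₀ (by positivity) (by linarith) d
  have hpm := fun θ => (hpm' θ).2
  have hη1 : 0 ≤ 1 - η := sub_nonneg.2 (hpm' fun _ => true).1
  have hη0 : 0 ≤ η := by positivity
  -- The density with bump `k` removed: both the background of the separation bound and the common
  -- minorant of the two neighbours.
  set W : (Fin d → Fin N) → ((Fin d → Fin N) → Bool) → E → ℝ := fun k θ x =>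
    (1 - η) * q x + ∑ j ∈ Finset.univ.erase k, a * φ (s⁻¹ • (x - shiftedGrid s v θ j)) with hW
  have hbi : ∀ c : E, Integrable fun x => a * φ (s⁻¹ • (x - c)) := fun c =>
    (integrable_comp_inv_smul_sub hφi hs c).const_mul a
  have hb0 : ∀ c x : E, 0 ≤ a * φ (s⁻¹ • (x - c)) := fun c x => mul_nonneg hapos.le (hφ0 _)
  have hWi : ∀ k θ, Integrable (W k θ) := fun k θ =>
    (hqi.const_mul _).add (integrable_finsetSum _ fun j _ => hbi _)
  have hW0 : ∀ k θ x, 0 ≤ W k θ x := fun k θ x =>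
    add_nonneg (mul_nonneg hη1 (hq0 x)) (Finset.sum_nonneg fun j _ => hb0 _ x)
  have hpW : ∀ k θ, p θ = fun x => W k θ x + a * φ (s⁻¹ • (x - shiftedGrid s v θ k)) := by
    intro k θ
    ext x
    simp only [hp, hW, bumpSum]
    rw [← Finset.sum_erase_add _ _ (Finset.mem_univ k), add_assoc]
  have hWflip : ∀ k θ, W k (flipAt k θ) = W k θ := by
    intro k θ
    ext x
    simp only [hW]
    congr 1
    refine Finset.sum_congr rfl fun j hj => ?_
    rw [shiftedGrid_flipAt_of_ne θ (Finset.ne_of_mem_erase hj)]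
  have hpW' : ∀ k θ, p (flipAt k θ)
      = fun x => W k θ x + a * φ (s⁻¹ • (x - shiftedGrid s v (flipAt k θ) k)) := by
    intro k θ
    rw [hpW k (flipAt k θ), hWflip]
  have hmassW : ∀ k θ, 1 - ∫ x, W k θ x ≤ 1 / (2 * n) := by
    intro k θ
    have h1 := (hpm θ).1.1.2.2
    rw [hpW k θ, integral_add (hWi k θ) (hbi _), integral_const_mul,
      integral_comp_inv_smul_sub φ hs, smul_eq_mul] at h1
    have h2 : κ * (2 * I) ≤ 1 := (le_div_iff₀ (by positivity)).1 (min_le_right _ _)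
    have h3 : a * (s ^ d * I) * (2 * n) = κ * (2 * I) := by
      linear_combination κ * 2 * I * hρn
    rw [le_div_iff₀ (by positivity)]
    have h4 : 1 - ∫ x, W k θ x = a * (s ^ d * I) := by rw [hIdef]; linarith
    rw [h4, h3]
    exact h2
  have hsmooth : ∀ k θ, ∀ x ∈ Metric.ball (gridPoint s k) (3 * s),
      smoothed (W k θ) (s ^ 2) x ≤ (U₀ / κ + 1) * a := by
    intro k θ x hx
    have ht : 0 < s ^ 2 := by positivity
    have hxR : R ≤ ‖x‖ := by
      have h1 := le_norm_gridPoint hd hs k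
      have h2 := norm_le_norm_add_norm_sub' (gridPoint s k) x
      rw [← dist_eq_norm, dist_comm] at h2
      rw [Metric.mem_ball] at hx
      linarith
    have h1 := htail s R hs hsB hR0 x hxR
    have h2 : smoothed (fun x => ∑ j ∈ Finset.univ.erase k,
        a * φ (s⁻¹ • (x - shiftedGrid s v θ j))) (s ^ 2) x ≤ a := by
      refine smoothed_le_of_le (integrable_finsetSum _ fun j _ => hbi _) ht (fun y => ?_) x
      refine le_trans ?_ (bumpSum_le hsupp hφ1 hapos.le hs (hdist θ) y)
      exact Finset.sum_le_sum_of_subset_of_nonneg (Finset.erase_subset _ _)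
        fun j _ _ => hb0 _ y
    have h3 : smoothed (W k θ) (s ^ 2) x = (1 - η) * smoothed q (s ^ 2) x
        + smoothed (fun x => ∑ j ∈ Finset.univ.erase k,
          a * φ (s⁻¹ • (x - shiftedGrid s v θ j))) (s ^ 2) x := by
      rw [← smoothed_const_mul]
      exact smoothed_add (hqi.const_mul _) (integrable_finsetSum _ fun j _ => hbi _) ht x
    have h4 : (1 - η) * smoothed q (s ^ 2) x ≤ smoothed q (s ^ 2) x :=
      mul_le_of_le_one_left (smoothed_nonneg hq0 ht x) (by linarith)
    have h5 : (U₀ / κ + 1) * a = U₀ * ρ + a := by rw [ha]; field_simp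
    rw [h3, h5]
    linarith
  have main := le_minimaxRisk_of_hypercube (n := n) (P := modelClass d γ C β L) (t := s ^ 2)
    (by positivity) hpm (fun θ => (hpm θ).1.1.1)
    (A := fun k => Metric.ball (gridPoint s k) (3 * s)) (fun k => measurableSet_ball)
    (fun k l hkl => Metric.ball_disjoint_ball (by linarith [le_dist_gridPoint hs hkl]))
    (Δ := ENNReal.ofReal (c₁ * (a * s ^ d / s ^ 2)))
    (fun k θ => ⟨W k θ, hWi k θ, hW0 k θ,
      fun x => by rw [hpW k θ]; exact le_add_of_nonneg_right (hb0 _ x),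
      fun x => by rw [hpW' k θ]; exact le_add_of_nonneg_right (hb0 _ x), hmassW k θ⟩)
    (fun k θ f hf => ?_)
  · refine le_trans ?_ main
    have h4 : (4 : ℝ≥0∞) = ENNReal.ofReal 4 := by simp
    rw [h4, ← ENNReal.ofReal_div_of_pos (by norm_num), ← ENNReal.ofReal_natCast,
      ← ENNReal.ofReal_mul (by positivity), hcard]
    refine ENNReal.ofReal_le_ofReal ?_
    have h5 : R ^ ((d : ℝ) - T) ≤ ρ * (s * N) ^ d := by
      calc R ^ ((d : ℝ) - T) = ρ * R ^ d := by
            rw [hρ, ← rpow_natCast R d, ← rpow_add hR0]; congr 1; ring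
        _ ≤ _ := by gcongr
    calc κ * c₁ / 4 * (R ^ ((d : ℝ) - T) / s ^ 2)
        ≤ κ * c₁ / 4 * (ρ * (s * N) ^ d / s ^ 2) := by gcongr
      _ = _ := by rw [ha, mul_pow]; ring
  · rcases shiftedGrid_flipAt_self (s := s) (v := v) θ k with ⟨h1, h2⟩ | ⟨h1, h2⟩
    · exact hsep s a (W k θ) (gridPoint s k) v hs hapos (hWi k θ) (hW0 k θ) hv (hsmooth k θ) _ _
        (by rw [hpW k θ, h1]) (by rw [hpW' k θ, h2]) f hf
    · rw [add_comm]
      exact hsep s a (W k θ) (gridPoint s k) v hs hapos (hWi k θ) (hW0 k θ) hv (hsmooth k θ) _ _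
        (by rw [hpW' k θ, h2]) (by rw [hpW k θ, h1]) f hf

/-- A single bump of mass 1 and large width `s` has Sobolev energy of order `s ^ (-d - 2 β)`, hence
meets the radius `L / 2`; being bounded with compact support, it meets the tail constraint for some
constant. -/
theorem exists_nondegenerateRadii (hd : 1 ≤ d) (γ : ℝ) {β L : ℝ} (hγ : 0 < γ) (hβ : 0 < β)
    (hL : 0 < L) : ∃ C₀ : ℝ, ∀ C : ℝ, C₀ ≤ C → NondegenerateRadii d γ C β L := by
  obtain ⟨φ, hφ, hsupp, hφ0, hφ1, hφi, hI⟩ := exists_smooth_bump d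
  obtain ⟨M, hM, hsob⟩ := exists_sobolev_bumpSum_le hφ hsupp β
  set I : ℝ := ∫ x, φ x with hIdef
  set Q : ℝ := (2 * π) ^ d * (L / 2) ^ 2 with hQ
  have hQpos : 0 < Q := by positivity
  set s : ℝ := max 1 (M / (I ^ 2 * Q)) with hs
  have hs1 : 1 ≤ s := le_max_left _ _
  have hs0 : 0 < s := by linarith
  set a : ℝ := 1 / (s ^ d * I) with ha
  have hapos : 0 < a := by positivity
  set T : ℝ := 1 + γ + d with hT
  have hTpos : 0 < T := by positivity
  set c : Unit → E := fun _ => 0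
  have hc : ∀ i j, i ≠ j → 2 * s < dist (c i) (c j) := fun i j h => absurd rfl h
  set p : E → ℝ := bumpSum φ a s c with hp
  have hdens : IsDensity p := by
    refine ⟨integrable_bumpSum hφi a hs0 c, fun x => Finset.sum_nonneg fun j _ =>
      mul_nonneg hapos.le (hφ0 _), ?_⟩
    rw [hp, integral_bumpSum hφi a hs0, ha, ← hIdef]
    simp only [Fintype.card_unit, Nat.cast_one, one_mul]
    field_simp
  refine ⟨a * (1 + s ^ 2) ^ (T / 2) + 1, fun C hC => ⟨a * (1 + s ^ 2) ^ (T / 2), L / 2,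
    by linarith, by positivity, by linarith, p, ⟨hdens, fun x => ?_⟩, hdens, fun α hα => ?_⟩⟩
  · have hE : 0 < (1 + ‖x‖ ^ 2) ^ (T / 2) := by positivity
    by_cases hx : ‖x‖ ≤ s
    · refine (bumpSum_le hsupp hφ1 hapos.le hs0 hc x).trans ?_
      rw [le_div_iff₀ hE]
      gcongr
    · rw [hp, bumpSum_eq_zero hsupp hs0 fun _ => by simpa [c] using hx]
      positivity
  · refine (hsob Unit a s c hs0 hc α hα).trans (ENNReal.ofReal_le_ofReal ?_)
    have h1 : a ^ 2 * s ^ d * s ^ (-(2 * β)) ≤ (I ^ 2)⁻¹ * s⁻¹ := by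
      have h2 : s ^ (-(2 * β)) ≤ 1 := rpow_le_one_of_one_le_of_nonpos hs1 (by linarith)
      have h3 : a ^ 2 * s ^ d = (I ^ 2)⁻¹ * (s ^ d)⁻¹ := by rw [ha]; field_simp
      have h4 : s ≤ s ^ d := le_self_pow₀ hs1 (by omega)
      calc a ^ 2 * s ^ d * s ^ (-(2 * β)) ≤ a ^ 2 * s ^ d * 1 := by gcongr
        _ = (I ^ 2)⁻¹ * (s ^ d)⁻¹ := by rw [mul_one, h3]
        _ ≤ _ := by gcongr
    have h5 : M / (I ^ 2 * Q) ≤ s := le_max_right _ _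
    rw [div_le_iff₀ (by positivity)] at h5
    simp only [Fintype.card_unit, Nat.cast_one, one_mul]
    calc M * (a ^ 2 * s ^ d * s ^ (-(2 * β))) ≤ M * ((I ^ 2)⁻¹ * s⁻¹) := by gcongr
      _ ≤ (s * (I ^ 2 * Q)) * ((I ^ 2)⁻¹ * s⁻¹) := by gcongr
      _ = Q := by field_simp

end LowerBound

/-! ### Exponents and the range of times -/

section Rates

theorem timeExp_pos {d : ℕ} (hd : 1 ≤ d) {γ β : ℝ} (hγ : 0 < γ) (hβ : 0 < β) :
    0 < timeExp d γ β := by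
  have : (1 : ℝ) ≤ d := by exact_mod_cast hd
  unfold timeExp; positivity

/-- This form shows where the exponent comes from: with `R ^ T = n t ^ (d / 2)` and `2 T - d = d + 2
γ + 2`, the energy condition `R ^ (d - 2 T) ≲ t ^ β` reads `n ≳ t ^ (-1 / τ)`. -/
theorem one_div_timeExp {d : ℕ} {γ β : ℝ} (hγ : 0 < γ) :
    1 / timeExp d γ β = d / 2 + β * (1 + γ + d) / (d + 2 * γ + 2) := by
  have : 0 < (d : ℝ) + 2 * γ + 2 := by positivity
  unfold timeExp
  rw [one_div_div]
  field_simp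
  ring

/-- In the admissible range of times, the radius `R = (n s ^ d) ^ (1 / (1 + γ + d))`, `s = √t`,
is large, and bumps of width `s` beyond it have bounded Sobolev energy. -/
theorem exists_radius_bounds {d : ℕ} (hd : 1 ≤ d) {γ β a b : ℝ} (hγ : 0 < γ) (hβ : 0 < β)
    (ha : 0 < a) : ∃ D : ℝ, 0 ≤ D ∧ ∃ n₀ : ℕ, ∀ n : ℕ, n₀ ≤ n → ∀ t : ℝ,
      a * (n : ℝ) ^ (-timeExp d γ β) ≤ t → t ≤ b → ∃ R : ℝ, 0 < t ∧ 0 < n ∧ 1 ≤ R ∧ √t ≤ R ∧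
        R ^ (1 + γ + d) = n * √t ^ d ∧
        R ^ ((d : ℝ) - 2 * (1 + γ + d)) ≤ D * √t ^ (2 * β) ∧
        R ^ ((d : ℝ) - (1 + γ + d))
          = (n : ℝ) ^ (-rateExp d γ) * t ^ (-((d : ℝ) / 2 * rateExp d γ)) := by
  have hdR : (1 : ℝ) ≤ d := by exact_mod_cast hd
  set τ := timeExp d γ β with hτ
  have hτpos : 0 < τ := timeExp_pos hd hγ hβ
  set T : ℝ := 1 + γ + d with hT
  have hTpos : 0 < T := by positivity
  set w : ℝ := d + 2 * γ + 2 with hw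
  have hwpos : 0 < w := by positivity
  have hτinv : 1 / τ = d / 2 + β * T / w := one_div_timeExp hγ
  -- Since `1 / τ > d / 2`, the quantity `n t ^ (d / 2)` tends to infinity uniformly over the
  -- admissible times; this forces `R ≥ max 1 √b` for large `n`.
  have hτd : 0 < 1 - τ * (d / 2) := by
    have h1 : τ * (1 / τ) = 1 := by field_simp
    rw [hτinv] at h1
    have h2 : 0 < τ * (β * T / w) := by positivity
    nlinarith
  set m : ℝ := max 1 (√b) ^ T with hm
  have hlim : Filter.Tendsto (fun n : ℕ => a ^ ((d : ℝ) / 2) * (n : ℝ) ^ (1 - τ * (d / 2)))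
      Filter.atTop Filter.atTop :=
    ((tendsto_rpow_atTop hτd).comp tendsto_natCast_atTop_atTop).const_mul_atTop (by positivity)
  obtain ⟨n₁, hn₁⟩ := Filter.eventually_atTop.1 (hlim.eventually_ge_atTop m)
  refine ⟨a ^ (-(w / (τ * T))), by positivity, max n₁ 1, fun n hn t hta htb => ?_⟩
  have hn0 : 0 < n := lt_of_lt_of_le one_pos ((le_max_right _ _).trans hn)
  have hnR : (0 : ℝ) < n := by exact_mod_cast hn0
  have ht : 0 < t := lt_of_lt_of_le (by positivity) hta
  have hs : 0 < √t := sqrt_pos.2 ht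
  have hsd : √t ^ d = t ^ ((d : ℝ) / 2) := by
    rw [sqrt_eq_rpow, ← rpow_natCast, ← rpow_mul ht.le]; congr 1; ring
  have hs2 : √t ^ (2 * β) = t ^ β := by
    rw [sqrt_eq_rpow, ← rpow_mul ht.le]; congr 1; ring
  set X : ℝ := n * √t ^ d with hX
  have hXpos : 0 < X := by positivity
  have hXm : m ≤ X := by
    refine (hn₁ n ((le_max_left _ _).trans hn)).trans ?_
    rw [hX, hsd]
    calc a ^ ((d : ℝ) / 2) * (n : ℝ) ^ (1 - τ * (d / 2))
        = n * (a * (n : ℝ) ^ (-τ)) ^ ((d : ℝ) / 2) := by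
          rw [mul_rpow ha.le (by positivity), ← rpow_mul hnR.le, sub_eq_add_neg, rpow_add hnR,
            rpow_one, neg_mul]
          ring
      _ ≤ _ := by gcongr
  have hRlow : max 1 (√b) ≤ X ^ (1 / T) := by
    calc max 1 (√b) = m ^ (1 / T) := by
          rw [hm, ← rpow_mul (by positivity), mul_one_div_cancel hTpos.ne', rpow_one]
      _ ≤ _ := by gcongr
  have hRpow : ∀ y : ℝ, (X ^ (1 / T)) ^ y = X ^ (y / T) := fun y => by
    rw [← rpow_mul hXpos.le]; congr 1; ring
  refine ⟨X ^ (1 / T), ht, hn0, (le_max_left _ _).trans hRlow,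
    (sqrt_le_sqrt htb).trans ((le_max_right _ _).trans hRlow), ?_, ?_, ?_⟩
  · rw [hRpow, div_self hTpos.ne', rpow_one]
  · rw [hRpow, hs2]
    have h1 : (a / t) ^ (1 / τ) ≤ n := by
      have h2 : a / t ≤ (n : ℝ) ^ τ := by
        rw [div_le_iff₀ ht]
        rw [rpow_neg hnR.le] at hta
        have h3 : 0 < (n : ℝ) ^ τ := by positivity
        rwa [← div_eq_mul_inv, div_le_iff₀ h3, mul_comm] at hta
      calc (a / t) ^ (1 / τ) ≤ ((n : ℝ) ^ τ) ^ (1 / τ) := by gcongr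
        _ = n := by rw [← rpow_mul hnR.le, mul_one_div_cancel hτpos.ne', rpow_one]
    have h2 : (a / t) ^ (1 / τ) * t ^ ((d : ℝ) / 2) ≤ X := by
      rw [hX, hsd]; gcongr
    have h3 : ((d : ℝ) - 2 * T) / T = -(w / T) := by rw [hT, hw]; ring
    rw [h3]
    calc X ^ (-(w / T)) ≤ ((a / t) ^ (1 / τ) * t ^ ((d : ℝ) / 2)) ^ (-(w / T)) :=
          rpow_le_rpow_of_nonpos (by positivity) h2 (by have := div_pos hwpos hTpos; linarith)
      _ = a ^ (-(w / (τ * T))) * t ^ β := by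
          rw [div_rpow ha.le ht.le, div_mul_eq_mul_div, mul_div_assoc, ← rpow_sub ht,
            mul_rpow (by positivity) (by positivity), ← rpow_mul ha.le, ← rpow_mul ht.le]
          congr 2
          · field_simp
          · rw [hτinv]; field_simp; ring
  · rw [hRpow]
    have h1 : ((d : ℝ) - T) / T = -rateExp d γ := by
      unfold rateExp
      rw [hT, ← neg_div]
      congr 1 <;> ring
    rw [h1, hX, hsd, mul_rpow (by positivity) (by positivity), ← rpow_mul ht.le]
    congr 2; ring

/-- The surplus exponent `x - y + δ` of `t` is positive, so `t ≤ b` bounds that power by a constant,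
while `n ^ (-δ) ≤ 1`. -/
theorem rate_le_rate {n : ℕ} (hn : 0 < n) {t b δ r x y : ℝ} (ht : 0 < t) (htb : t ≤ b)
    (hδ : 0 < δ) (hxy : y ≤ x) :
    (n : ℝ) ^ (-r - δ) * t ^ (-1 + x + δ) ≤ b ^ (x - y + δ) * ((n : ℝ) ^ (-r) * t ^ y / t) := by
  have hnR : (1 : ℝ) ≤ n := by exact_mod_cast hn
  have h1 : (n : ℝ) ^ (-r - δ) ≤ (n : ℝ) ^ (-r) :=
    rpow_le_rpow_of_exponent_le hnR (by linarith)
  have h2 : t ^ (-1 + x + δ) = t ^ (x - y + δ) * (t ^ y / t) := by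
    rw [div_eq_mul_inv, ← rpow_neg_one t, ← rpow_add ht, ← rpow_add ht]
    congr 1; ring
  have h3 : t ^ (x - y + δ) ≤ b ^ (x - y + δ) := rpow_le_rpow ht.le htb (by linarith)
  rw [h2]
  calc (n : ℝ) ^ (-r - δ) * (t ^ (x - y + δ) * (t ^ y / t))
      ≤ (n : ℝ) ^ (-r) * (b ^ (x - y + δ) * (t ^ y / t)) := by gcongr
    _ = _ := by ring

end Rates

/-! ### The theorem -/

theorem theorem9 (d : ℕ) (hd : 1 ≤ d) (γ β L : ℝ) (hγ : 0 < γ) (hβ : 0 < β) (hL : 0 < L) :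
    (∃ C₀ : ℝ, ∀ C : ℝ, C₀ ≤ C → NondegenerateRadii d γ C β L) ∧
    ∀ C : ℝ, NondegenerateRadii d γ C β L →
      ∀ δ : ℝ, 0 < δ → ∀ a b : ℝ, 0 < a → 0 < b →
        ∃ c : ℝ, 0 < c ∧ ∃ n₀ : ℕ, ∀ n : ℕ, n₀ ≤ n →
          ∀ t : ℝ, a * (n : ℝ) ^ (-timeExp d γ β) ≤ t → t ≤ b →
            ENNReal.ofReal (c * (n : ℝ) ^ (-rateExp d γ - δ) *
                t ^ (-1 - (d : ℝ) / 2 * rateExp d γ + δ))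
              ≤ minimaxRisk (modelClass d γ C β L) n t ∧
            (2 ≤ d →
              ENNReal.ofReal (c * (n : ℝ) ^ (-rateExp d γ - δ) *
                  t ^ (-1 - rateExp d γ + δ))
                ≤ minimaxRisk (modelClass d γ C β L) n t) := by
  refine ⟨exists_nondegenerateRadii hd γ hγ hβ hL, fun C hC δ hδ a b ha hb => ?_⟩
  obtain ⟨D, hD, n₀, hrad⟩ := exists_radius_bounds (b := b) hd hγ hβ ha
  obtain ⟨c, hc, hlow⟩ := exists_minimaxRisk_ge_of_scale hd hγ hC (sqrt_pos.2 hb) hD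
  set r := rateExp d γ with hr
  have hrpos : 0 < r := by rw [hr]; unfold rateExp; positivity
  set y : ℝ := -((d : ℝ) / 2 * r) with hy
  -- Both claims weaken the sharp rate `n ^ (-r) t ^ (y - 1)`: the first takes `x = y`, the second
  -- `x = -r`, which is at least `y = -d r / 2` exactly because `d ≥ 2`.
  have key : ∀ x : ℝ, y ≤ x → ∀ c' : ℝ, 0 < c' → c' * b ^ (x - y + δ) ≤ c → ∀ n : ℕ, n₀ ≤ n →
      ∀ t : ℝ, a * (n : ℝ) ^ (-timeExp d γ β) ≤ t → t ≤ b →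
        ENNReal.ofReal (c' * (n : ℝ) ^ (-r - δ) * t ^ (-1 + x + δ))
          ≤ minimaxRisk (modelClass d γ C β L) n t := by
    intro x hxy c' hc' hcc n hn t hta htb
    obtain ⟨R, ht, hn0, hR1, hsR, hRn, hRD, hRr⟩ := hrad n hn t hta htb
    have h1 := hlow n (√t) R hn0 (sqrt_pos.2 ht) (sqrt_le_sqrt htb) hR1 hsR hRn hRD
    rw [sq_sqrt ht.le, hRr] at h1
    refine le_trans (ENNReal.ofReal_le_ofReal ?_) h1
    calc c' * (n : ℝ) ^ (-r - δ) * t ^ (-1 + x + δ)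
        = c' * ((n : ℝ) ^ (-r - δ) * t ^ (-1 + x + δ)) := by ring
      _ ≤ c' * (b ^ (x - y + δ) * ((n : ℝ) ^ (-r) * t ^ y / t)) := by
          exact mul_le_mul_of_nonneg_left (rate_le_rate hn0 ht htb hδ hxy) hc'.le
      _ = c' * b ^ (x - y + δ) * ((n : ℝ) ^ (-r) * t ^ y / t) := by ring
      _ ≤ _ := by gcongr
  refine ⟨min (c / b ^ (y - y + δ)) (c / b ^ (-r - y + δ)), by positivity, n₀,
    fun n hn t hta htb => ⟨?_, fun h2 => ?_⟩⟩
  · have h := key y le_rfl (min (c / b ^ (y - y + δ)) (c / b ^ (-r - y + δ))) (by positivity)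
      ((le_div_iff₀ (by positivity)).1 (min_le_left _ _)) n hn t hta htb
    rwa [hy, ← sub_eq_add_neg, ← hy] at h
  · have hd2 : (2 : ℝ) ≤ d := by exact_mod_cast h2
    have h := key (-r) (by rw [hy]; nlinarith) (min (c / b ^ (y - y + δ)) (c / b ^ (-r - y + δ)))
      (by positivity) ((le_div_iff₀ (by positivity)).1 (min_le_right _ _)) n hn t hta htb
    rwa [← sub_eq_add_neg] at h
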